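/- Let $D$ be a finite connected bipartite graph (a dimer; nodes coloured black and white, multiple edges allowed) cellularly embedded in the oriented torus $T^2=\mathbb R^2/\mathbb Z^2$, i.e. every face (component of the complement) is an open disc; such an embedding is described combinatorially by the counterclockwise order of the edges around every node, together with the identification $H_1(T^2)\cong\mathbb Z^2$. A zigzag path is a closed path in $D$ that turns at every white node from the edge on which it arrives to the next edge in counterclockwise order, and at every black node to the next edge in clockwise order. Every edge $e$ is traversed exactly twice by zigzag paths, once in each direction, and is regarded as an intersection of the two (possibly equal) paths concerned. Every zigzag path $Z$ has a winding number $\mathbf w_Z\in\mathbb Z^2$, its class in $H_1(T^2)$. A node of valence $n$ has $n$ corners (pairs of consecutive edges), and exactly one zigzag path turns at each corner; let $\mathbf w_0,\dots,\mathbf w_{n-1}$ be the winding numbers of these paths in counterclockwise order of the corners. The node is called properly ordered if all $\mathbf w_i$ are nonzero, cyclically consecutive ones $\mathbf w_i,\mathbf w_{i+1}$ (the windings of the two paths that intersect on an edge at the node; $\mathbf w_0,\mathbf w_0$ if $n=1$) never have the same direction, and the directions of $\mathbf w_0,\dots,\mathbf w_{n-1}$ are, in this order, in strict counterclockwise circular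 order. The dimer is called properly ordered if all its nodes are. Let $P$ be the convex lattice polygon (possibly degenerate, unique up to translation) whose $(p,q)$-legs are the winding numbers of the zigzag paths: its sides are the vectors $\mathbf w_Z$, rotated by $90^\circ$ and laid tip to tail in the order of their directions, where vectors in the same direction form a single side and zero vectors contribute nothing. Then $D$ is properly ordered if and only if $D$ has no node of valence one and the number of faces of $D$ equals $2\,\mathrm{area}(P)$. -/

import Mathlib

open MeasureTheory

noncomputable section

/-- A bipartite graph (multiple edges allowed, no isolated nodes) cellularly embedded in a closed
oriented surface, given by its rotation system.  `E` is the set of edges; every edge has one white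
and one black endpoint.  `white e` (resp. `black e`) is the edge that follows `e` in
counterclockwise order around the white (resp. black) endpoint of `e`.  The surface is obtained by
gluing a disc to every face. -/
structure BipartiteMap (E : Type*) where
  white : Equiv.Perm E
  black : Equiv.Perm E

namespace BipartiteMap

variable {E : Type*} (D : BipartiteMap E)

/-- White nodes are the cycles of `white`. -/
abbrev WhiteNode : Type _ := Quotient (Equiv.Perm.SameCycle.setoid D.white)

/-- Black nodes are the cycles of `black`. -/
abbrev BlackNode : Type _ := Quotient (Equiv.Perm.SameCycle.setoid D.black)

abbrev Node : Type _ := D.WhiteNode ⊕ D.BlackNode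

/-- The white endpoint of an edge. -/
def whiteEnd (e : E) : D.WhiteNode := Quotient.mk _ e

/-- The black endpoint of an edge. -/
def blackEnd (e : E) : D.BlackNode := Quotient.mk _ e

/-- The underlying (simple) graph of the dimer. -/
def graph : SimpleGraph D.Node where
  Adj u v := ∃ e : E,
    (u = Sum.inl (D.whiteEnd e) ∧ v = Sum.inr (D.blackEnd e)) ∨
    (v = Sum.inl (D.whiteEnd e) ∧ u = Sum.inr (D.blackEnd e))
  symm := ⟨fun _ _ ⟨e, h⟩ => ⟨e, h.symm⟩⟩
  loopless := ⟨fun u ⟨e, h⟩ => by rcases h with ⟨h₁, h₂⟩ | ⟨h₁, h₂⟩ <;> simp [h₁] at h₂⟩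

/-- The number of edges at a node. -/
def valence : D.Node → ℕ
  | Sum.inl w => Nat.card {e : E // D.whiteEnd e = w}
  | Sum.inr b => Nat.card {e : E // D.blackEnd e = b}

/-- Walk along `e` from its white to its black endpoint, keeping a face on the left.  At the black
endpoint the boundary of that face continues along the edge `black⁻¹ e` that is next in clockwise
order, from black to white, and then along the edge `white⁻¹ (black⁻¹ e)`, from white to black
again. -/
def facePerm : Equiv.Perm E := D.white⁻¹ * D.black⁻¹

/-- Faces are the cycles of `facePerm`: a face corresponds to the set of edges which have it on
their left when they are traversed from white to black. -/
abbrev Face : Type _ := Quotient (Equiv.Perm.SameCycle.setoid D.facePerm)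

/-- The face to the left of `e`, traversed from white to black. -/
def leftFace (e : E) : D.Face := Quotient.mk _ e

/-- The face to the right of `e`, traversed from white to black. -/
def rightFace (e : E) : D.Face := Quotient.mk _ (D.black e)

def numFaces : ℕ := Nat.card D.Face

/-- A zigzag path turns from `e` to the counterclockwise next edge `white e` at a white node, follows
it to its black endpoint, turns there to the clockwise next edge `black⁻¹ (white e)`, and follows
that edge to its white endpoint. -/
def zigzagPerm : Equiv.Perm E := D.black⁻¹ * D.white

/-- Zigzag paths are the cycles of `zigzagPerm`; the edges in such a cycle are the edges that the
path traverses from black to white. -/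
abbrev Zigzag : Type _ := Quotient (Equiv.Perm.SameCycle.setoid D.zigzagPerm)

/-- The zigzag path that traverses `e` from black to white.  It contains the corner from `e` to
`white e` at the white endpoint of `e` and the corner from `black e` to `e` at the black endpoint
of `e`.  (The zigzag path that traverses `e` from white to black is
`zigzagOf (white⁻¹ e) = zigzagOf (black⁻¹ e)`.) -/
def zigzagOf (e : E) : D.Zigzag := Quotient.mk _ e

section Homology

variable [Fintype E]

open Classical in
/-- A cellular 1-chain `z`, where every edge is oriented from white to black, is a cycle if its
boundary vanishes at every node. -/
def IsCycle (z : E → ℤ) : Prop :=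
  (∀ w : D.WhiteNode, ∑ e with D.whiteEnd e = w, z e = 0) ∧
  (∀ b : D.BlackNode, ∑ e with D.blackEnd e = b, z e = 0)

/-- A cellular 1-chain is a boundary if it is the boundary of a 2-chain `c`; the boundary of a face
runs counterclockwise, so that it has the face on its left. -/
def IsBoundary (z : E → ℤ) : Prop :=
  ∃ c : D.Face → ℤ, ∀ e, z e = c (D.leftFace e) - c (D.rightFace e)

end Homology

/-- The wedge product `(a, b) ∧ (c, d) = ad - bc`. -/
def wedge (u v : ℤ × ℤ) : ℤ := u.1 * v.2 - u.2 * v.1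

/-- Suppose that the edge `e`, lifted to the plane, leads from its white endpoint to a point displaced
by `disp e`.  Start at the origin with the white endpoint of `e` and walk along the boundary of the
face to the left of `e`.  This is the position after `2 * k` steps, at the white endpoint of
`facePerm ^ k e`. -/
def facePos (disp : E → ℤ × ℤ) (e : E) (k : ℕ) : ℤ × ℤ :=
  ∑ i ∈ Finset.range k,
    (disp ((D.facePerm ^ i) e) - disp (D.black⁻¹ ((D.facePerm ^ i) e)))

/-- Twice the signed area (by the shoelace formula) of the closed polygon in the plane which
is the lift of the boundary of the face to the left of `e`.  Its consecutive vertices are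
`P₀, P₀ + d₀, P₁, P₁ + d₁, …`, where `Pₖ = facePos k` are the positions of white nodes and
`dₖ = disp (facePerm ^ k e)`. -/
def faceArea₂ (disp : E → ℤ × ℤ) (e : E) : ℤ :=
  ∑ k ∈ Finset.range (Function.minimalPeriod D.facePerm e),
    (wedge (D.facePos disp e k) (D.facePos disp e k + disp ((D.facePerm ^ k) e)) +
     wedge (D.facePos disp e k + disp ((D.facePerm ^ k) e)) (D.facePos disp e (k + 1)))

open Classical in
/-- An identification (up to homotopy) of the surface of the map with the oriented torus `ℝ² / ℤ²`.

Choose a lift to the plane of every node.  An edge that starts at the chosen lift of its white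
endpoint then ends at a translate of the chosen lift of its black endpoint by a vector
`disp e ∈ ℤ²`, so that the winding number of a closed path is the signed sum of `disp` over its
edges.  The boundary of every face lifts to a closed path, and `disp` induces an isomorphism from
the first homology group (cycles modulo boundaries) onto `ℤ²`, the first homology group
of the torus.  The identification has degree one: the faces, developed into the
plane, cover the torus exactly once with positive orientation, so that their signed areas add up to
`1`, the area of the torus.  (In other words, the cup product of the two components of `disp`
has the value `1` on the fundamental class.  The sum does not depend on the lifts nor on the
starting points of the faces.) -/
structure TorusMarking [Fintype E] where
  disp : E → ℤ × ℤ
  face_closed : ∀ f : D.Face, ∑ e with D.leftFace e = f, (disp e - disp (D.black⁻¹ e)) = 0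
  homology_injective : ∀ z : E → ℤ, D.IsCycle z → ∑ e, z e • disp e = 0 → D.IsBoundary z
  homology_surjective : ∀ w : ℤ × ℤ, ∃ z : E → ℤ, D.IsCycle z ∧ ∑ e, z e • disp e = w
  degree_one : ∑ f : D.Face, D.faceArea₂ disp f.out = 2

variable {D} [Fintype E]

open Classical in
/-- The winding number of a zigzag path: it traverses the edges `e` of its cycle from black to white
and the edges `white e` from white to black. -/
def TorusMarking.winding (T : D.TorusMarking) (Z : D.Zigzag) : ℤ × ℤ :=
  ∑ e with D.zigzagOf e = Z, (T.disp (D.white e) - T.disp e)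

end BipartiteMap

/-- The argument in `(-π, π]` of an integer vector. -/
def vecArg (w : ℤ × ℤ) : ℝ := Complex.arg ⟨(w.1 : ℝ), (w.2 : ℝ)⟩

/-- The direction of a nonzero integer vector, as a point of the circle `ℝ / 2πℤ` (with its
counterclockwise circular order). -/
def vecDir (w : ℤ × ℤ) : Real.Angle := (vecArg w : Real.Angle)

namespace BipartiteMap

variable {E : Type*} [Fintype E] {D : BipartiteMap E}

/-- `rot` is `white` or `black`.  In both cases the zigzag paths in counterclockwise order around the
node at the end of `e` are `zigzagOf e, zigzagOf (rot e), zigzagOf (rot² e), …`, one for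
every corner.  The node is properly ordered if no such path has winding zero, no two of them that
intersect on an edge at the node have windings in the same direction, and their order
is the circular order of the directions of their windings. -/
def TorusMarking.OrderedAt (T : D.TorusMarking) (rot : Equiv.Perm E) (e : E) : Prop :=
  (∀ e', rot.SameCycle e e' → T.winding (D.zigzagOf e') ≠ 0) ∧
  (∀ e', rot.SameCycle e e' →
    vecDir (T.winding (D.zigzagOf e')) ≠ vecDir (T.winding (D.zigzagOf (rot e')))) ∧
  (∀ e', rot.SameCycle e e' → ∀ i j : ℕ, 0 < i → i < j → j < Function.minimalPeriod rot e' →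
    sbtw (vecDir (T.winding (D.zigzagOf e')))
      (vecDir (T.winding (D.zigzagOf ((rot ^ i) e'))))
      (vecDir (T.winding (D.zigzagOf ((rot ^ j) e')))))

/-- A node is properly ordered if the zigzag paths around it are. -/
def TorusMarking.NodeProperlyOrdered (T : D.TorusMarking) : D.Node → Prop
  | Sum.inl w => ∀ e, D.whiteEnd e = w → T.OrderedAt D.white e
  | Sum.inr b => ∀ e, D.blackEnd e = b → T.OrderedAt D.black e

/-- A dimer is properly ordered if all its nodes are. -/
def TorusMarking.ProperlyOrdered (T : D.TorusMarking) : Prop :=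
  ∀ v : D.Node, T.NodeProperlyOrdered v

end BipartiteMap

open Classical in
/-- The convex polygon whose `(p, q)`-legs are the vectors `w i` (with sum zero).  Its sides are the
vectors `w i`, rotated by 90 degrees counterclockwise and laid tip to tail in the order of their
arguments, so that `w i` is an outward normal, of the same length, of its side (vectors
in the same direction are pieces of a single side, and zero vectors contribute nothing).  Its
vertices are therefore the sums of the sides with argument of `w i` at most `θ`. -/
def legPolygon {ι : Type*} [Fintype ι] (w : ι → ℤ × ℤ) : Set (ℝ × ℝ) :=
  convexHull ℝ {p | ∃ θ : ℝ, p = ∑ i with vecArg (w i) ≤ θ, (-((w i).2 : ℝ), ((w i).1 : ℝ))}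

open Classical in
/-- The area of the polygon whose `(p, q)`-legs are the winding numbers of the zigzag paths. -/
def BipartiteMap.TorusMarking.zigzagArea {E : Type*} [Fintype E] {D : BipartiteMap E}
    (T : D.TorusMarking) : ℝ :=
  (volume (legPolygon T.winding)).toReal

end

/-!
Every edge is a crossing of the two zigzag paths through it, and the intersection number of two
zigzag paths is the wedge product of their winding numbers.  Summing the wedge products in the order
of the directions therefore expresses twice the area of the polygon as a sum over the edges: an edge
contributes the sign of the step of the direction from one corner at its white end to the next (and
the sign is the same at its black end).  Around a node of valence `n ≥ 2` these signs add up to at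
most `n - 2`, with equality if and only if the directions increase strictly around the node, apart
from a single descent, or `n = 2` and the two directions agree.  If there are no nodes of valence
one, this and Euler's formula `#E = #W + #B + #F` bound twice the area by the number `#F` of faces,
with equality if and only if all nodes are extremal.

Paths with winding zero and nodes with agreeing directions are excluded in the case of equality as
follows.  A path with winding zero may be placed at any position in the order of directions without
changing the sum, in particular at the position of a path that it crosses.  A vanishing sign at one
edge spreads from node to node to all edges, because only the second kind of extremal node admits
it, and then the area vanishes although there are faces.
-/

section PlaneGeometry

/-- The determinant of two vectors of the plane, as a bilinear form: twice the signed area of the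
triangle that they span. -/
noncomputable def planeDet : (ℝ × ℝ) →ₗ[ℝ] (ℝ × ℝ) →ₗ[ℝ] ℝ :=
  LinearMap.mk₂ ℝ (fun u v => u.1 * v.2 - u.2 * v.1)
    (fun u u' v => by simp only [Prod.fst_add, Prod.snd_add]; ring)
    (fun c u v => by simp only [Prod.smul_fst, Prod.smul_snd, smul_eq_mul]; ring)
    (fun u v v' => by simp only [Prod.fst_add, Prod.snd_add]; ring)
    (fun c u v => by simp only [Prod.smul_fst, Prod.smul_snd, smul_eq_mul]; ring)

theorem planeDet_apply (u v : ℝ × ℝ) : planeDet u v = u.1 * v.2 - u.2 * v.1 := rfl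

@[simp]
theorem planeDet_self (u : ℝ × ℝ) : planeDet u u = 0 := by
  rw [planeDet_apply]
  ring

theorem planeDet_swap (u v : ℝ × ℝ) : planeDet v u = -planeDet u v := by
  simp only [planeDet_apply]
  ring

theorem planeDet_smul_eq_add (u v w : ℝ × ℝ) :
    planeDet u w • v = planeDet v w • u + planeDet u v • w := by
  ext <;> simp only [planeDet_apply, Prod.fst_add, Prod.snd_add, Prod.smul_fst, Prod.smul_snd,
    smul_eq_mul] <;> ring

theorem volume_setOf_planeDet_eq_zero {u : ℝ × ℝ} (hu : u ≠ 0) :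
    volume {x : ℝ × ℝ | planeDet x u = 0} = 0 := by
  refine Measure.addHaar_submodule volume (LinearMap.ker (planeDet.flip u)) fun htop => hu ?_
  have hdet (x : ℝ × ℝ) : planeDet x u = 0 := by
    simpa using htop.ge (Submodule.mem_top (x := x))
  ext
  · simpa [planeDet_apply] using hdet (0, 1)
  · simpa [planeDet_apply] using hdet (1, 0)

theorem planeDet_le_of_mem_convexHull {X : Set (ℝ × ℝ)} {u y : ℝ × ℝ} {c : ℝ}
    (h : ∀ x ∈ X, planeDet x u ≤ c) (hy : y ∈ convexHull ℝ X) : planeDet y u ≤ c :=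
  convexHull_min h (convex_halfSpace_le (planeDet.flip u).isLinear c) hy

theorem planeDet_nonneg_of_mem_convexHull {X : Set (ℝ × ℝ)} {u y : ℝ × ℝ}
    (h : ∀ x ∈ X, 0 ≤ planeDet x u) (hy : y ∈ convexHull ℝ X) : 0 ≤ planeDet y u :=
  convexHull_min h (convex_halfSpace_ge (planeDet.flip u).isLinear 0) hy

theorem volume_convexHull_eq_zero_of_planeDet_eq_zero {X : Set (ℝ × ℝ)} {u : ℝ × ℝ} (hu : u ≠ 0)
    (h : ∀ x ∈ X, planeDet x u = 0) : volume (convexHull ℝ X) = 0 :=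
  measure_mono_null
    (fun _ hx => (planeDet_le_of_mem_convexHull (fun x hx => (h x hx).le) hx).antisymm
      (planeDet_nonneg_of_mem_convexHull (fun x hx => (h x hx).ge) hx))
    (volume_setOf_planeDet_eq_zero hu)

theorem volume_standardTriangle :
    volume {p : ℝ × ℝ | 0 ≤ p.1 ∧ 0 ≤ p.2 ∧ p.1 + p.2 ≤ 1} = ENNReal.ofReal (1 / 2) := by
  have hslice (x : ℝ) :
      volume (Prod.mk x ⁻¹' {p : ℝ × ℝ | 0 ≤ p.1 ∧ 0 ≤ p.2 ∧ p.1 + p.2 ≤ 1}) =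
        (Set.Icc (0 : ℝ) 1).indicator (fun x => ENNReal.ofReal (1 - x)) x := by
    by_cases hx : x ∈ Set.Icc (0 : ℝ) 1
    · rw [Set.indicator_of_mem hx, ← sub_zero (1 - x), ← Real.volume_Icc]
      congr 1
      ext y
      simp [hx.1, le_sub_iff_add_le']
    · rw [Set.indicator_of_notMem hx]
      refine measure_mono_null (fun y hy => hx ?_) measure_empty
      exact ⟨hy.1, by linarith [hy.2.1, hy.2.2]⟩
  have hmeas : MeasurableSet {p : ℝ × ℝ | 0 ≤ p.1 ∧ 0 ≤ p.2 ∧ p.1 + p.2 ≤ 1} := by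
    measurability
  rw [Measure.volume_eq_prod, Measure.prod_apply hmeas]
  simp_rw [hslice]
  rw [lintegral_indicator measurableSet_Icc, ← ofReal_integral_eq_lintegral_ofReal]
  · rw [integral_Icc_eq_integral_Ioc, ← intervalIntegral.integral_of_le zero_le_one,
      intervalIntegral.integral_sub (by simp) (by simp), integral_id]
    norm_num
  · exact (continuous_const.sub continuous_id).integrableOn_Icc
  · filter_upwards [ae_restrict_mem measurableSet_Icc] with x hx
    simpa using hx.2

theorem convexHull_zero_pair (q r : ℝ × ℝ) :
    convexHull ℝ {0, q, r} =
      (LinearMap.toSpanSingleton ℝ (ℝ × ℝ) q).coprod (LinearMap.toSpanSingleton ℝ (ℝ × ℝ) r) ''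
        {p | 0 ≤ p.1 ∧ 0 ≤ p.2 ∧ p.1 + p.2 ≤ 1} := by
  have hconvex : Convex ℝ {p : ℝ × ℝ | 0 ≤ p.1 ∧ 0 ≤ p.2 ∧ p.1 + p.2 ≤ 1} :=
    (convex_halfSpace_ge (LinearMap.fst ℝ ℝ ℝ).isLinear 0).inter <|
      (convex_halfSpace_ge (LinearMap.snd ℝ ℝ ℝ).isLinear 0).inter <|
        convex_halfSpace_le (LinearMap.fst ℝ ℝ ℝ + LinearMap.snd ℝ ℝ ℝ).isLinear 1
  refine (convexHull_min ?_ (hconvex.linear_image _)).antisymm ?_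
  · rintro x (rfl | rfl | rfl)
    · exact ⟨0, by simp⟩
    · exact ⟨(1, 0), by simp⟩
    · exact ⟨(0, 1), by simp⟩
  · rintro _ ⟨p, ⟨hp₁, hp₂, hp⟩, rfl⟩
    have hmem := (convex_convexHull ℝ {0, q, r}).sum_mem (t := Finset.univ)
      (w := ![1 - (p.1 + p.2), p.1, p.2]) (z := ![0, q, r])
      (by simp [Fin.forall_fin_succ, hp₁, hp₂, hp])
      (by simp [Fin.sum_univ_three, add_assoc])
      (fun i _ => subset_convexHull ℝ _ (by fin_cases i <;> simp))
    simpa [Fin.sum_univ_three] using hmem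

theorem volume_convexHull_zero_pair (q r : ℝ × ℝ) :
    volume (convexHull ℝ {0, q, r}) = ENNReal.ofReal (|planeDet q r| / 2) := by
  have hdet : LinearMap.det ((LinearMap.toSpanSingleton ℝ (ℝ × ℝ) q).coprod
      (LinearMap.toSpanSingleton ℝ (ℝ × ℝ) r)) = planeDet q r := by
    rw [← LinearMap.det_toMatrix (Module.Basis.finTwoProd ℝ), Matrix.det_fin_two]
    simp [LinearMap.toMatrix_apply, planeDet_apply, mul_comm]
  rw [convexHull_zero_pair, Measure.addHaar_image_linearMap, hdet, volume_standardTriangle,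
    ← ENNReal.ofReal_mul (abs_nonneg _), mul_one_div]

theorem segment_subset_union {x y z : ℝ × ℝ} (hz : z ∈ segment ℝ x y) :
    segment ℝ x y ⊆ segment ℝ x z ∪ segment ℝ z y := by
  rw [← insert_endpoints_openSegment]
  have hsub := openSegment_subset_union (𝕜 := ℝ) x y
    (segment_eq_image_lineMap ℝ x y ▸ Set.image_subset_range _ _ <| hz)
  rintro w (rfl | rfl | hw)
  · exact .inl (left_mem_segment ℝ w z)
  · exact .inr (right_mem_segment ℝ z w)
  · rcases hsub hw with rfl | hw | hw
    · exact .inl (right_mem_segment ℝ x w)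
    · exact .inl (openSegment_subset_segment ℝ x z hw)
    · exact .inr (openSegment_subset_segment ℝ z y hw)

section AttachTriangle

variable {X : Set (ℝ × ℝ)} {q r x : ℝ × ℝ}

theorem smul_mem_segment_inter_segment (hpos : 0 < planeDet q r + planeDet x q)
    (hqr : 0 ≤ planeDet q r) (hxr : 0 ≤ planeDet x r) (hxq : 0 ≤ planeDet x q)
    (hturn : 0 ≤ planeDet (q - x) (r - q)) :
    (planeDet x r / (planeDet q r + planeDet x q)) • q ∈ segment ℝ 0 q ∩ segment ℝ x r := by
  set d := planeDet q r + planeDet x q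
  have hle : planeDet x r ≤ d := by
    simp only [map_sub, LinearMap.sub_apply, planeDet_self] at hturn
    linarith
  constructor
  · refine ⟨1 - planeDet x r / d, planeDet x r / d, ?_, by positivity, by ring, by simp⟩
    rwa [sub_nonneg, div_le_one hpos]
  · refine ⟨planeDet q r / d, planeDet x q / d, by positivity, by positivity, ?_, ?_⟩
    · rw [← add_div, div_self hpos.ne']
    · simp only [div_eq_inv_mul, mul_smul]
      rw [← smul_add, ← planeDet_smul_eq_add]

theorem convexHull_insert_eq_union (h0 : 0 ∈ X) (hq : q ∈ X) (hqr : 0 < planeDet q r)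
    (hr : ∀ x ∈ X, 0 ≤ planeDet x r) (hxq : ∀ x ∈ X, 0 ≤ planeDet x q)
    (hturn : ∀ x ∈ X, 0 ≤ planeDet (q - x) (r - q)) :
    convexHull ℝ (insert r X) = convexHull ℝ X ∪ convexHull ℝ {0, q, r} := by
  refine Set.Subset.antisymm ?_ (Set.union_subset (convexHull_mono (Set.subset_insert r X))
    (convexHull_mono ?_))
  · rw [convexHull_insert ⟨0, h0⟩, convexJoin_singleton_left]
    refine Set.iUnion₂_subset fun x hx => ?_
    have hxq' := planeDet_nonneg_of_mem_convexHull hxq hx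
    have hturn' : 0 ≤ planeDet (q - x) (r - q) := by
      have := planeDet_le_of_mem_convexHull (u := r - q) (c := planeDet q (r - q))
        (fun x hx => by simpa using hturn x hx) hx
      simpa using this
    obtain ⟨hz0q, hzxr⟩ := smul_mem_segment_inter_segment (by positivity) hqr.le
      (planeDet_nonneg_of_mem_convexHull hr hx) hxq' hturn'
    rw [segment_symm]
    refine (segment_subset_union hzxr).trans (Set.union_subset_union ?_ ?_)
    · exact (convex_convexHull ℝ X).segment_subset hx
        (segment_subset_convexHull h0 hq hz0q)
    · exact (convex_convexHull ℝ _).segment_subset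
        (segment_subset_convexHull (by simp) (by simp) hz0q) (subset_convexHull ℝ _ (by simp))
  · rintro x (rfl | rfl | rfl)
    · exact .inr h0
    · exact .inr hq
    · exact .inl rfl

theorem volume_convexHull_insert_of_planeDet_eq_zero (h0 : 0 ∈ X) (hq : q ∈ X)
    (hqr : planeDet q r = 0)
    (hr : ∀ x ∈ X, 0 ≤ planeDet x r) (hxq : ∀ x ∈ X, 0 ≤ planeDet x q)
    (hturn : ∀ x ∈ X, 0 ≤ planeDet (q - x) (r - q)) :
    volume (convexHull ℝ (insert r X)) = volume (convexHull ℝ X) := by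
  have hline (u : ℝ × ℝ) (hu : u ≠ 0) (hur : planeDet r u = 0) (hX : ∀ x ∈ X, planeDet x u = 0) :
      volume (convexHull ℝ (insert r X)) = volume (convexHull ℝ X) := by
    rw [volume_convexHull_eq_zero_of_planeDet_eq_zero hu hX,
      volume_convexHull_eq_zero_of_planeDet_eq_zero hu
        (Set.forall_mem_insert.2 ⟨hur, hX⟩)]
  by_cases hX : ∀ x ∈ X, planeDet x q = 0
  · rcases eq_or_ne q 0 with rfl | hq0
    · rcases eq_or_ne r 0 with rfl | hr0
      · rw [Set.insert_eq_of_mem h0]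
      · refine hline r hr0 (planeDet_self r) fun x hx => (hr x hx).antisymm' ?_
        simpa using hturn x hx
    · exact hline q hq0 (by rw [planeDet_swap, hqr, neg_zero]) hX
  · push Not at hX
    obtain ⟨x, hx, hxq0⟩ := hX
    have hpos : 0 < planeDet x q := (hxq x hx).lt_of_ne' hxq0
    have hr' : r = (planeDet x r / (planeDet q r + planeDet x q)) • q := by
      rw [hqr, zero_add, div_eq_inv_mul, mul_smul, planeDet_smul_eq_add, hqr, zero_smul, zero_add,
        inv_smul_smul₀ hpos.ne']
    have hrX : r ∈ convexHull ℝ X := segment_subset_convexHull h0 hq <| by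
      rw [hr']
      exact (smul_mem_segment_inter_segment (by rwa [hqr, zero_add]) hqr.ge (hr x hx) hpos.le
        (hturn x hx)).1
    rw [(convexHull_mono (Set.subset_insert r X)).antisymm'
      (convexHull_min (Set.insert_subset hrX (subset_convexHull ℝ X)) (convex_convexHull ℝ X))]

theorem volume_convexHull_insert (h0 : 0 ∈ X) (hq : q ∈ X)
    (hr : ∀ x ∈ X, 0 ≤ planeDet x r) (hxq : ∀ x ∈ X, 0 ≤ planeDet x q)
    (hturn : ∀ x ∈ X, 0 ≤ planeDet (q - x) (r - q)) :
    volume (convexHull ℝ (insert r X)) =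
      volume (convexHull ℝ X) + ENNReal.ofReal (planeDet q r / 2) := by
  rcases (hr q hq).eq_or_lt' with hqr | hqr
  · rw [volume_convexHull_insert_of_planeDet_eq_zero h0 hq hqr hr hxq hturn, hqr, zero_div,
      ENNReal.ofReal_zero, add_zero]
  · have hq0 : q ≠ 0 := by
      rintro rfl
      simp at hqr
    have hinter : convexHull ℝ X ∩ convexHull ℝ {0, q, r} ⊆ {x | planeDet x q = 0} := by
      rintro x ⟨hxX, hxT⟩
      refine (planeDet_nonneg_of_mem_convexHull hxq hxX).antisymm'
        (planeDet_le_of_mem_convexHull ?_ hxT)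
      simp [planeDet_swap q r, hqr.le]
    rw [convexHull_insert_eq_union h0 hq hqr hr hxq hturn, measure_union₀' _
      (measure_mono_null hinter (volume_setOf_planeDet_eq_zero hq0)),
      volume_convexHull_zero_pair, abs_of_pos hqr]
    exact (convex_convexHull ℝ X).nullMeasurableSet _

end AttachTriangle

end PlaneGeometry

section OrderedPolygon

/-- The unit vector at angle `θ + π / 2`: the direction of a side of a convex polygon with outward
normal at angle `θ`, when the polygon is traversed counterclockwise. -/
noncomputable def sideDirection (θ : ℝ) : ℝ × ℝ := (-Real.sin θ, Real.cos θ)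

theorem planeDet_sideDirection (θ φ : ℝ) :
    planeDet (sideDirection θ) (sideDirection φ) = Real.sin (φ - θ) := by
  rw [planeDet_apply, Real.sin_sub]
  simp only [sideDirection]
  ring

theorem planeDet_sideDirection_add_pi (p : ℝ × ℝ) (x : ℝ) :
    planeDet p (sideDirection (x + Real.pi)) = -planeDet p (sideDirection x) := by
  simp only [planeDet_apply, sideDirection, Real.sin_add_pi, Real.cos_add_pi]
  ring

theorem planeDet_sideDirection_mul_sin (p : ℝ × ℝ) (x y z : ℝ) :
    planeDet p (sideDirection y) * Real.sin (z - x) =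
      planeDet p (sideDirection x) * Real.sin (z - y) +
        planeDet p (sideDirection z) * Real.sin (y - x) := by
  simp only [← planeDet_sideDirection, planeDet_apply]
  ring

theorem planeDet_sideDirection_pos_of_mem_Ioo {p : ℝ × ℝ} {x y z : ℝ} (hy : y ∈ Set.Ioo x z)
    (hz : z ≤ x + Real.pi) (hpx : 0 ≤ planeDet p (sideDirection x))
    (hpz : 0 ≤ planeDet p (sideDirection z))
    (hpos : planeDet p (sideDirection x) ≠ 0 ∨ planeDet p (sideDirection z) ≠ 0) :
    0 < planeDet p (sideDirection y) := by
  have hsin₁ : 0 < Real.sin (z - y) :=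
    Real.sin_pos_of_pos_of_lt_pi (sub_pos.2 hy.2) (by linarith [hy.1])
  have hsin₂ : 0 < Real.sin (y - x) :=
    Real.sin_pos_of_pos_of_lt_pi (sub_pos.2 hy.1) (by linarith [hy.2])
  have hsin : 0 ≤ Real.sin (z - x) :=
    Real.sin_nonneg_of_nonneg_of_le_pi (by linarith [hy.1, hy.2]) (by linarith)
  refine pos_of_mul_pos_left ?_ hsin
  rw [planeDet_sideDirection_mul_sin]
  rcases hpos with h | h <;> positivity

theorem planeDet_sideDirection_nonneg_of_signs {p : ℝ × ℝ} {x₁ x₂ x₃ x₄ : ℝ} (h₁₂ : x₁ < x₂)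
    (h₂₃ : x₂ < x₃) (h₃₄ : x₃ < x₄) (h₄₁ : x₄ < x₁ + 2 * Real.pi)
    (hp₁ : 0 ≤ planeDet p (sideDirection x₁)) (hp₃ : 0 < planeDet p (sideDirection x₃))
    (hp₄ : planeDet p (sideDirection x₄) ≤ 0) : 0 ≤ planeDet p (sideDirection x₂) := by
  by_contra! hp₂
  have h₃₁ : x₁ + Real.pi < x₃ := by
    by_contra! h
    exact hp₂.not_gt
      (planeDet_sideDirection_pos_of_mem_Ioo ⟨h₁₂, h₂₃⟩ h hp₁ hp₃.le (.inr hp₃.ne'))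
  have h₄₂ : x₂ + Real.pi < x₄ := by
    by_contra! h
    have := planeDet_sideDirection_pos_of_mem_Ioo (p := -p) ⟨h₂₃, h₃₄⟩ h (by simpa using hp₂.le)
      (by simpa using hp₄) (.inl (by simpa using hp₂.ne))
    simp only [map_neg, LinearMap.neg_apply] at this
    linarith
  have hopp := planeDet_sideDirection_pos_of_mem_Ioo (p := p) (x := x₄ - Real.pi)
    (y := x₁ + Real.pi) (z := x₃) ⟨by linarith, h₃₁⟩ (by linarith)
    (by
      have := planeDet_sideDirection_add_pi p (x₄ - Real.pi)
      rw [sub_add_cancel] at this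
      linarith) hp₃.le (.inr hp₃.ne')
  rw [planeDet_sideDirection_add_pi] at hopp
  linarith

variable {ι : Type*} [Fintype ι]

/-- The end point of the path of all sides with outward normal at angle at most `t`, laid tip to
tail from the origin in the order of their angles; side `i` has length `ρ i` and outward normal
at angle `θ i`. -/
noncomputable def polygonVertex (ρ θ : ι → ℝ) (t : ℝ) : ℝ × ℝ :=
  ∑ i with θ i ≤ t, ρ i • sideDirection (θ i)

variable {ρ θ : ι → ℝ} {s t t' m φ : ℝ}

theorem polygonVertex_congr (h : ∀ i, θ i ≤ s ↔ θ i ≤ t) :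
    polygonVertex ρ θ s = polygonVertex ρ θ t := by
  simp only [polygonVertex, h]

theorem polygonVertex_sub (hst : s ≤ t) :
    polygonVertex ρ θ t - polygonVertex ρ θ s =
      ∑ i with s < θ i ∧ θ i ≤ t, ρ i • sideDirection (θ i) := by
  classical
  rw [sub_eq_iff_eq_add, polygonVertex, polygonVertex, ← Finset.sum_union]
  · congr 1
    ext i
    simp only [Finset.mem_filter_univ, Finset.mem_union]
    grind
  · exact Finset.disjoint_filter.2 fun i _ h => not_le.2 h.1

theorem image_polygonVertex_Iic (ht'm : t' < m) (hmt : m ≤ t)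
    (hgap : ∀ i, θ i ≤ t → θ i ≤ t' ∨ θ i = m) :
    polygonVertex ρ θ '' Set.Iic t =
      insert (polygonVertex ρ θ m) (polygonVertex ρ θ '' Set.Iic t') := by
  refine Set.Subset.antisymm ?_ (Set.insert_subset ⟨m, hmt, rfl⟩
    (Set.image_mono (Set.Iic_subset_Iic.2 (ht'm.le.trans hmt))))
  rintro _ ⟨x, hx, rfl⟩
  rcases le_or_gt m x with hmx | hxm
  · exact .inl (polygonVertex_congr fun i => by grind)
  · exact .inr ⟨min x t', min_le_right x t', polygonVertex_congr fun i => by grind⟩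

theorem polygonVertex_sub_of_gap (ht'm : t' < m) (hgap : ∀ i, θ i ≤ m → θ i ≤ t' ∨ θ i = m) :
    polygonVertex ρ θ m - polygonVertex ρ θ t' = (∑ i with θ i = m, ρ i) • sideDirection m := by
  rw [polygonVertex_sub ht'm.le, Finset.sum_smul]
  refine Finset.sum_congr (Finset.filter_congr fun i _ => by grind) fun i hi => ?_
  rw [(Finset.mem_filter_univ i).1 hi]

variable (hρ : ∀ i, 0 ≤ ρ i) (hθ : ∀ i, θ i ∈ Set.Ioc (-Real.pi) Real.pi)
  (hsum : ∑ i, ρ i • sideDirection (θ i) = 0)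

include hθ in
theorem polygonVertex_eq_zero_of_le (ht : t ≤ -Real.pi) : polygonVertex ρ θ t = 0 :=
  Finset.sum_eq_zero fun i hi =>
    absurd ((Finset.mem_filter_univ i).1 hi) (ht.trans_lt (hθ i).1).not_ge

include hθ hsum in
theorem polygonVertex_eq_zero_of_ge (ht : Real.pi ≤ t) : polygonVertex ρ θ t = 0 := by
  rw [polygonVertex, Finset.filter_true_of_mem fun i _ => (hθ i).2.trans ht, hsum]

include hρ hθ hsum in
theorem planeDet_polygonVertex_self_nonneg (hφ : φ ≤ Real.pi) :
    0 ≤ planeDet (polygonVertex ρ θ φ) (sideDirection φ) := by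
  rcases le_total φ 0 with hφ0 | hφ0
  · simp only [polygonVertex, map_sum, map_smul, LinearMap.sum_apply, LinearMap.smul_apply,
      planeDet_sideDirection, smul_eq_mul]
    refine Finset.sum_nonneg fun i hi => mul_nonneg (hρ i) ?_
    rw [Finset.mem_filter_univ] at hi
    exact Real.sin_nonneg_of_nonneg_of_le_pi (by linarith) (by linarith [(hθ i).1])
  · have hrest := polygonVertex_sub (ρ := ρ) (θ := θ) hφ
    rw [polygonVertex_eq_zero_of_ge hθ hsum le_rfl, zero_sub, neg_eq_iff_eq_neg] at hrest
    simp only [hrest, map_neg, LinearMap.neg_apply, map_sum, map_smul, LinearMap.sum_apply,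
      LinearMap.smul_apply, planeDet_sideDirection, smul_eq_mul, ← Finset.sum_neg_distrib,
      ← mul_neg]
    refine Finset.sum_nonneg fun i hi => mul_nonneg (hρ i) ?_
    rw [Finset.mem_filter_univ] at hi
    rw [← Real.sin_neg, neg_sub]
    exact Real.sin_nonneg_of_nonneg_of_le_pi (by linarith) (by linarith [(hθ i).2])

include hρ hθ hsum in
theorem planeDet_polygonVertex_le (ht : t ≤ φ) (hφ : φ ≤ Real.pi) :
    planeDet (polygonVertex ρ θ t) (sideDirection φ) ≤
      planeDet (polygonVertex ρ θ φ) (sideDirection φ) := by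
  rcases le_or_gt (φ - Real.pi) t with hφt | hφt
  · rw [← sub_nonneg, ← LinearMap.sub_apply, ← map_sub, polygonVertex_sub ht]
    simp only [map_sum, map_smul, LinearMap.sum_apply, LinearMap.smul_apply,
      planeDet_sideDirection, smul_eq_mul]
    refine Finset.sum_nonneg fun i hi => mul_nonneg (hρ i) ?_
    rw [Finset.mem_filter_univ] at hi
    exact Real.sin_nonneg_of_nonneg_of_le_pi (by linarith) (by linarith)
  · refine le_trans ?_ (planeDet_polygonVertex_self_nonneg hρ hθ hsum hφ)
    simp only [polygonVertex, map_sum, map_smul, LinearMap.sum_apply, LinearMap.smul_apply,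
      planeDet_sideDirection, smul_eq_mul]
    refine Finset.sum_nonpos fun i hi => mul_nonpos_of_nonneg_of_nonpos (hρ i) ?_
    rw [Finset.mem_filter_univ] at hi
    rw [← Real.sin_sub_two_pi]
    exact Real.sin_nonpos_of_nonpos_of_neg_pi_le (by linarith [(hθ i).1]) (by linarith)

include hρ in
theorem exists_planeDet_sideDirection_pos {p : ℝ × ℝ} (hst : s ≤ t)
    (h : 0 < planeDet p (polygonVertex ρ θ t - polygonVertex ρ θ s)) :
    ∃ i, s < θ i ∧ θ i ≤ t ∧ 0 < planeDet p (sideDirection (θ i)) := by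
  rw [polygonVertex_sub hst, map_sum] at h
  by_contra! hle
  refine h.not_ge (Finset.sum_nonpos fun i hi => ?_)
  rw [Finset.mem_filter_univ] at hi
  rw [map_smul]
  exact smul_nonpos_of_nonneg_of_nonpos (hρ i) (hle i hi.1 hi.2)

include hρ hθ hsum in
theorem planeDet_polygonVertex_nonneg (hst : s ≤ t) :
    0 ≤ planeDet (polygonVertex ρ θ s) (polygonVertex ρ θ t) := by
  rcases le_or_gt s (-Real.pi) with hs | hs
  · simp [polygonVertex_eq_zero_of_le hθ hs]
  rcases le_or_gt Real.pi t with ht | ht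
  · simp [polygonVertex_eq_zero_of_ge hθ hsum ht]
  by_contra! hneg
  obtain ⟨a, hsa, hat, ha⟩ := exists_planeDet_sideDirection_pos (p := -polygonVertex ρ θ s)
    (θ := θ) hρ hst (by simpa using hneg)
  obtain ⟨b, htb, hbpi, hb⟩ := exists_planeDet_sideDirection_pos (p := polygonVertex ρ θ s)
    (θ := θ) hρ ht.le (by simpa [polygonVertex_eq_zero_of_ge hθ hsum le_rfl] using hneg)
  have hpi : planeDet (polygonVertex ρ θ s) (sideDirection Real.pi) ≤ 0 := by
    simpa [polygonVertex_eq_zero_of_ge hθ hsum le_rfl] using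
      planeDet_polygonVertex_le hρ hθ hsum (hst.trans ht.le) le_rfl
  have hbpi' : θ b ≠ Real.pi := fun h => hb.not_ge (h ▸ hpi)
  refine (neg_pos.1 (by simpa using ha)).not_ge
    (planeDet_sideDirection_nonneg_of_signs hsa (hat.trans_lt htb) (hbpi.lt_of_ne hbpi')
      (by linarith) (planeDet_polygonVertex_self_nonneg hρ hθ hsum (hst.trans ht.le)) hb hpi)

include hρ hθ hsum in
theorem volume_convexHull_image_polygonVertex_of_gap (hm : m ≤ Real.pi)
    (ht'm : t' < m) (hmt : m ≤ t) (hgap : ∀ i, θ i ≤ t → θ i ≤ t' ∨ θ i = m) :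
    volume (convexHull ℝ (polygonVertex ρ θ '' Set.Iic t)) =
      volume (convexHull ℝ (polygonVertex ρ θ '' Set.Iic t')) +
        ∑ j with θ j = m,
          ENNReal.ofReal (ρ j * planeDet (polygonVertex ρ θ m) (sideDirection m) / 2) := by
  have hside := polygonVertex_sub_of_gap (ρ := ρ) ht'm fun i hi => hgap i (hi.trans hmt)
  have hvertex := sub_eq_iff_eq_add'.1 hside
  have hsupport : planeDet (polygonVertex ρ θ t') (sideDirection m) =
      planeDet (polygonVertex ρ θ m) (sideDirection m) := by
    simp [hvertex]
  have hm0 := planeDet_polygonVertex_self_nonneg hρ hθ hsum hm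
  have hzero : 0 ∈ polygonVertex ρ θ '' Set.Iic t' :=
    ⟨min (-Real.pi) t', Set.mem_Iic.2 (min_le_right _ _),
      polygonVertex_eq_zero_of_le hθ (min_le_left _ _)⟩
  have hlast : polygonVertex ρ θ t' ∈ polygonVertex ρ θ '' Set.Iic t' := ⟨t', Set.self_mem_Iic, rfl⟩
  rw [image_polygonVertex_Iic ht'm hmt hgap, volume_convexHull_insert hzero hlast]
  · rw [← ENNReal.ofReal_sum_of_nonneg fun j _ => div_nonneg (mul_nonneg (hρ j) hm0) zero_le_two,
      ← Finset.sum_div, ← Finset.sum_mul]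
    simp [hvertex]
  · rintro _ ⟨x, hx, rfl⟩
    exact planeDet_polygonVertex_nonneg hρ hθ hsum (hx.trans ht'm.le)
  · rintro _ ⟨x, hx, rfl⟩
    exact planeDet_polygonVertex_nonneg hρ hθ hsum hx
  · rintro _ ⟨x, hx, rfl⟩
    rw [hside, map_smul, map_sub, LinearMap.sub_apply, hsupport]
    exact smul_nonneg (Finset.sum_nonneg fun i _ => hρ i)
      (sub_nonneg.2 (planeDet_polygonVertex_le hρ hθ hsum (hx.trans ht'm.le) hm))

theorem exists_lt_forall_le_of_lt {ι : Type*} [Finite ι] (θ : ι → ℝ) (m : ℝ) :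
    ∃ t < m, ∀ i, θ i < m → θ i ≤ t := by
  have hle : ∀ᶠ t in nhdsWithin m (Set.Iio m), ∀ i, θ i < m → θ i ≤ t := by
    rw [Filter.eventually_all]
    refine fun i => Filter.eventually_imp_distrib_left.2 fun hi => ?_
    filter_upwards [Ioo_mem_nhdsLT hi] with t ht using ht.1.le
  exact (eventually_mem_nhdsWithin.and hle).exists

include hρ hθ hsum in
theorem volume_convexHull_image_polygonVertex (t : ℝ) :
    volume (convexHull ℝ (polygonVertex ρ θ '' Set.Iic t)) =
      ∑ j with θ j ≤ t,
        ENNReal.ofReal (ρ j * planeDet (polygonVertex ρ θ (θ j)) (sideDirection (θ j)) / 2) := by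
  classical
  induction hn : (Finset.univ.filter fun i => θ i ≤ t).card using Nat.strong_induction_on
    generalizing t with
  | _ n ih =>
    rcases (Finset.univ.filter fun i => θ i ≤ t).eq_empty_or_nonempty with hempty | hne
    · have hzero : polygonVertex ρ θ '' Set.Iic t ⊆ {0} := by
        rintro _ ⟨x, hx, rfl⟩
        refine Finset.sum_eq_zero fun i hi => ?_
        rw [Finset.mem_filter_univ] at hi
        exact absurd (hi.trans hx) (Finset.filter_eq_empty_iff.1 hempty (Finset.mem_univ i))
      rw [hempty, Finset.sum_empty]
      refine measure_mono_null (convexHull_min hzero (convex_singleton 0)) (measure_singleton 0)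
    · obtain ⟨k, hk, hmax⟩ := Finset.exists_max_image _ θ hne
      simp only [Finset.mem_filter_univ] at hk hmax
      obtain ⟨t', ht'm, ht'⟩ := exists_lt_forall_le_of_lt θ (θ k)
      have hgap (i : ι) (hi : θ i ≤ t) : θ i ≤ t' ∨ θ i = θ k :=
        (hmax i hi).lt_or_eq.imp_left (ht' i)
      have hunion : (Finset.univ.filter fun i => θ i ≤ t) =
          (Finset.univ.filter fun i => θ i ≤ t') ∪ Finset.univ.filter fun i => θ i = θ k := by
        ext i
        simp only [Finset.mem_filter_univ, Finset.mem_union]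
        grind
      have hdisj : Disjoint (Finset.univ.filter fun i => θ i ≤ t')
          (Finset.univ.filter fun i => θ i = θ k) :=
        Finset.disjoint_filter.2 fun i _ hi => (hi.trans_lt ht'm).ne
      have hcard : (Finset.univ.filter fun i => θ i ≤ t').card < n := by
        rw [← hn, hunion, Finset.card_union_of_disjoint hdisj]
        exact Nat.lt_add_of_pos_right (Finset.card_pos.2 ⟨k, by simp⟩)
      rw [volume_convexHull_image_polygonVertex_of_gap hρ hθ hsum (hθ k).2 ht'm hk hgap,
        ih _ hcard t' rfl, hunion, Finset.sum_union hdisj]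
      congr 1
      refine Finset.sum_congr rfl fun j hj => ?_
      rw [(Finset.mem_filter_univ j).1 hj]

theorem vecArg_mem_Ioc (w : ℤ × ℤ) : vecArg w ∈ Set.Ioc (-Real.pi) Real.pi :=
  Complex.arg_mem_Ioc _

theorem norm_smul_sideDirection_vecArg (w : ℤ × ℤ) :
    ‖(⟨w.1, w.2⟩ : ℂ)‖ • sideDirection (vecArg w) = (-(w.2 : ℝ), (w.1 : ℝ)) := by
  ext
  · simp only [sideDirection, vecArg, Prod.smul_fst, smul_eq_mul, mul_neg]
    rw [Complex.norm_mul_sin_arg]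
  · simp only [sideDirection, vecArg, Prod.smul_snd, smul_eq_mul]
    rw [Complex.norm_mul_cos_arg]

theorem legPolygon_eq_convexHull_image (w : ι → ℤ × ℤ) :
    legPolygon w = convexHull ℝ
      (polygonVertex (fun i => ‖(⟨(w i).1, (w i).2⟩ : ℂ)‖) (fun i => vecArg (w i)) ''
        Set.Iic Real.pi) := by
  rw [legPolygon]
  congr 1
  ext p
  constructor
  · rintro ⟨t, rfl⟩
    refine ⟨min t Real.pi, Set.mem_Iic.2 (min_le_right t Real.pi), ?_⟩
    simp [polygonVertex, norm_smul_sideDirection_vecArg, (vecArg_mem_Ioc _).2]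
  · rintro ⟨t, -, rfl⟩
    exact ⟨t, by simp [polygonVertex, norm_smul_sideDirection_vecArg]⟩

theorem two_mul_volume_legPolygon (w : ι → ℤ × ℤ) (hw : ∑ i, w i = 0) :
    2 * (volume (legPolygon w)).toReal =
      ∑ j, ∑ i with vecArg (w i) ≤ vecArg (w j), (BipartiteMap.wedge (w i) (w j) : ℝ) := by
  set ρ : ι → ℝ := fun i => ‖(⟨(w i).1, (w i).2⟩ : ℂ)‖
  set θ : ι → ℝ := fun i => vecArg (w i)
  have hside (i : ι) : ρ i • sideDirection (θ i) = (-((w i).2 : ℝ), ((w i).1 : ℝ)) :=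
    norm_smul_sideDirection_vecArg (w i)
  have hρ (i : ι) : 0 ≤ ρ i := norm_nonneg _
  have hθ (i : ι) : θ i ∈ Set.Ioc (-Real.pi) Real.pi := vecArg_mem_Ioc (w i)
  have hsum : ∑ i, ρ i • sideDirection (θ i) = 0 := by
    rw [Prod.ext_iff, Prod.fst_sum, Prod.snd_sum] at hw
    ext
    · simp only [hside, Prod.fst_sum, Finset.sum_neg_distrib, Prod.fst_zero]
      exact_mod_cast neg_eq_zero.2 hw.2
    · simp only [hside, Prod.snd_sum, Prod.snd_zero]
      exact_mod_cast hw.1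
  rw [legPolygon_eq_convexHull_image, volume_convexHull_image_polygonVertex hρ hθ hsum,
    Finset.filter_true_of_mem fun i _ => (hθ i).2, ENNReal.toReal_sum (by simp), Finset.mul_sum]
  refine Finset.sum_congr rfl fun j _ => ?_
  rw [ENNReal.toReal_ofReal (div_nonneg (mul_nonneg (hρ j)
    (planeDet_polygonVertex_self_nonneg hρ hθ hsum (hθ j).2)) zero_le_two),
    mul_div_cancel₀ _ two_ne_zero, ← smul_eq_mul, ← map_smul, hside, polygonVertex, map_sum,
    LinearMap.sum_apply]
  refine Finset.sum_congr rfl fun i _ => ?_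
  rw [hside, planeDet_apply]
  simp [BipartiteMap.wedge]
  ring

end OrderedPolygon

section Cycles

variable {E : Type*}

theorem pow_succ_perm_apply (f : Equiv.Perm E) (k : ℕ) (e : E) :
    (f ^ (k + 1)) e = f ((f ^ k) e) := by
  rw [pow_succ', Equiv.Perm.mul_apply]

theorem pow_minimalPeriod_apply (f : Equiv.Perm E) (e : E) :
    (f ^ Function.minimalPeriod f e) e = e := by
  rw [Equiv.Perm.coe_pow]
  exact Function.iterate_minimalPeriod

theorem pow_sub_minimalPeriod_apply {f : Equiv.Perm E} {e : E} {k : ℕ}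
    (hk : Function.minimalPeriod f e ≤ k) :
    (f ^ (k - Function.minimalPeriod f e)) e = (f ^ k) e := by
  conv_rhs => rw [← Nat.sub_add_cancel hk, pow_add, Equiv.Perm.mul_apply, pow_minimalPeriod_apply]

section Finite

variable [Finite E]

theorem minimalPeriod_perm_pos (f : Equiv.Perm E) (e : E) : 0 < Function.minimalPeriod f e :=
  Function.minimalPeriod_pos_of_mem_periodicPts (f.injective.mem_periodicPts e)

theorem two_le_minimalPeriod {f : Equiv.Perm E} {e : E} (h : f e ≠ e) :
    2 ≤ Function.minimalPeriod f e := by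
  have hpos := minimalPeriod_perm_pos f e
  have hne : Function.minimalPeriod f e ≠ 1 := fun h1 =>
    h (Function.minimalPeriod_eq_one_iff_isFixedPt.1 h1)
  omega

theorem exists_pow_lt_minimalPeriod_eq {f : Equiv.Perm E} {e e' : E} (h : f.SameCycle e e') :
    ∃ k < Function.minimalPeriod f e, (f ^ k) e = e' := by
  obtain ⟨k, hk⟩ := h.exists_nat_pow_eq
  refine ⟨k % Function.minimalPeriod f e, Nat.mod_lt _ (minimalPeriod_perm_pos f e), ?_⟩
  rw [← hk, Equiv.Perm.coe_pow, Equiv.Perm.coe_pow, Function.iterate_mod_minimalPeriod_eq]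

theorem minimalPeriod_eq_of_sameCycle {f : Equiv.Perm E} {e e' : E} (h : f.SameCycle e e') :
    Function.minimalPeriod f e' = Function.minimalPeriod f e := by
  obtain ⟨k, -, rfl⟩ := exists_pow_lt_minimalPeriod_eq h
  rw [Equiv.Perm.coe_pow]
  exact Function.minimalPeriod_apply_iterate (f.injective.mem_periodicPts e) k

end Finite

section CycleFinset

variable [Fintype E]

open Classical in
/-- The cycle of a permutation through a point, including the trivial cycle through a fixed point
(which distinguishes it from the support of `Equiv.Perm.cycleOf`). -/
noncomputable def cycleFinset (f : Equiv.Perm E) (e : E) : Finset E := {e' | f.SameCycle e e'}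

theorem mem_cycleFinset {f : Equiv.Perm E} {e e' : E} :
    e' ∈ cycleFinset f e ↔ f.SameCycle e e' := by
  simp [cycleFinset]

theorem cycleFinset_eq_of_sameCycle {f : Equiv.Perm E} {e e' : E} (h : f.SameCycle e e') :
    cycleFinset f e = cycleFinset f e' := by
  ext x
  rw [mem_cycleFinset, mem_cycleFinset]
  exact ⟨h.symm.trans, h.trans⟩

theorem sum_range_minimalPeriod {M : Type*} [AddCommMonoid M] (f : Equiv.Perm E) (e : E)
    (F : E → M) :
    ∑ k ∈ Finset.range (Function.minimalPeriod f e), F ((f ^ k) e) =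
      ∑ e' ∈ cycleFinset f e, F e' := by
  refine Finset.sum_bij (fun k _ => (f ^ k) e) (fun k _ => ?_) (fun i hi j hj hij => ?_)
    (fun e' he' => ?_) fun _ _ => rfl
  · exact mem_cycleFinset.2 (Equiv.Perm.sameCycle_pow_right.2 (Equiv.Perm.SameCycle.refl f e))
  · exact Function.iterate_injOn_Iio_minimalPeriod (Finset.mem_range.1 hi) (Finset.mem_range.1 hj)
      (by simpa only [Equiv.Perm.coe_pow] using hij)
  · obtain ⟨k, hk, rfl⟩ := exists_pow_lt_minimalPeriod_eq (mem_cycleFinset.1 he')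
    exact ⟨k, Finset.mem_range.2 hk, rfl⟩

theorem card_cycleFinset (f : Equiv.Perm E) (e : E) :
    (cycleFinset f e).card = Function.minimalPeriod f e := by
  simpa using (sum_range_minimalPeriod f e fun _ => (1 : ℕ)).symm

open Classical in
theorem filter_mk_sameCycle_eq (f : Equiv.Perm E) (e : E) :
    ({e' | (Quotient.mk (Equiv.Perm.SameCycle.setoid f) e') = Quotient.mk _ e} : Finset E) =
      cycleFinset f e := by
  ext e'
  rw [Finset.mem_filter_univ, mem_cycleFinset, Quotient.eq]
  exact Equiv.Perm.sameCycle_comm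

open Classical in
theorem sum_sum_cycleFinset {M : Type*} [AddCommMonoid M] (f : Equiv.Perm E) (F : E → M) :
    ∑ c : Quotient (Equiv.Perm.SameCycle.setoid f), ∑ e ∈ cycleFinset f c.out, F e = ∑ e, F e := by
  rw [← Finset.sum_fiberwise Finset.univ (Quotient.mk (Equiv.Perm.SameCycle.setoid f))]
  refine Finset.sum_congr rfl fun c _ => ?_
  rw [← filter_mk_sameCycle_eq, Quotient.out_eq]

end CycleFinset

theorem card_mk_sameCycle_eq [Finite E] (f : Equiv.Perm E) (e : E) :
    Nat.card {e' // Quotient.mk (Equiv.Perm.SameCycle.setoid f) e' = Quotient.mk _ e} =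
      Function.minimalPeriod f e := by
  classical
  have := Fintype.ofFinite E
  rw [Nat.subtype_card _ fun e' => Finset.mem_filter_univ e', filter_mk_sameCycle_eq,
    card_cycleFinset]

section StepSign

variable {α : Type*} [LinearOrder α] {f : Equiv.Perm E} {θ : E → α}

/-- `+1`, `-1` or `0` according to whether `θ` increases, decreases or stays constant from `e` to
`f e`.  The sum over a cycle of `f` counts ascents minus descents around that cycle. -/
def stepSign (f : Equiv.Perm E) (θ : E → α) (e : E) : ℤ :=
  (if θ e ≤ θ (f e) then 1 else 0) - (if θ (f e) ≤ θ e then 1 else 0)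

theorem stepSign_eq_one {e : E} : stepSign f θ e = 1 ↔ θ e < θ (f e) := by
  grind [stepSign]

theorem stepSign_of_gt {e : E} (h : θ (f e) < θ e) : stepSign f θ e = -1 := by
  grind [stepSign]

theorem stepSign_eq_zero {e : E} : stepSign f θ e = 0 ↔ θ (f e) = θ e := by
  grind [stepSign]

theorem stepSign_le_one (f : Equiv.Perm E) (θ : E → α) (e : E) : stepSign f θ e ≤ 1 := by
  grind [stepSign]

/-- `θ` increases strictly once around the cycle of `f`, starting at `m`. -/
def IncreasesFrom (f : Equiv.Perm E) (θ : E → α) (m : E) : Prop :=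
  StrictMonoOn (fun k : ℕ => θ ((f ^ k) m)) (Set.Iio (Function.minimalPeriod f m))

theorem eq_of_no_descent [Finite E] {e : E} (h : ∀ e', f.SameCycle e e' → θ e' ≤ θ (f e')) {e' : E}
    (he' : f.SameCycle e e') : θ (f e') = θ e' := by
  have hmono : Monotone fun k : ℕ => θ ((f ^ k) e') := monotone_nat_of_le_succ fun k => by
    rw [pow_succ_perm_apply]
    exact h _ (Equiv.Perm.sameCycle_pow_right.2 he')
  refine le_antisymm ?_ (h e' he')
  simpa [pow_minimalPeriod_apply] using hmono (minimalPeriod_perm_pos f e' : 1 ≤ _)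

theorem increasesFrom_of_single_descent [Finite E] {d : E}
    (h : ∀ e, f.SameCycle d e → e ≠ d → θ e < θ (f e)) : IncreasesFrom f θ (f d) := by
  have hper : Function.minimalPeriod f (f d) = Function.minimalPeriod f d :=
    minimalPeriod_eq_of_sameCycle
      (Equiv.Perm.sameCycle_apply_right.2 (Equiv.Perm.SameCycle.refl f d))
  refine strictMonoOn_of_lt_add_one Set.ordConnected_Iio fun i _ _ hi => ?_
  have hpow : ∀ k, (f ^ k) (f d) = (f ^ (k + 1)) d := fun k => by
    rw [pow_succ, Equiv.Perm.mul_apply]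
  simp only [Set.mem_Iio, hper] at hi
  simp only [pow_succ_perm_apply]
  rw [hpow]
  refine h _ (Equiv.Perm.sameCycle_pow_right.2 (Equiv.Perm.SameCycle.refl f d)) fun hd => ?_
  have hdvd := (Function.isPeriodicPt_iff_minimalPeriod_dvd (f := f)).1
    (show f^[i + 1] d = d by rwa [← Equiv.Perm.coe_pow])
  exact absurd (Nat.le_of_dvd (by omega) hdvd) (by omega)

theorem IncreasesFrom.apply_ne [Finite E] {m e : E} (h : IncreasesFrom f θ m)
    (he : f.SameCycle m e) (hf : f e ≠ e) : θ e ≠ θ (f e) := by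
  have htwo := two_le_minimalPeriod hf
  rw [minimalPeriod_eq_of_sameCycle he] at htwo
  obtain ⟨t, ht, rfl⟩ := exists_pow_lt_minimalPeriod_eq he
  rw [← pow_succ_perm_apply]
  rcases lt_or_ge (t + 1) (Function.minimalPeriod f m) with hlt | hge
  · exact (h ht hlt t.lt_succ_self).ne
  · rw [← pow_sub_minimalPeriod_apply hge]
    exact (h (show t + 1 - _ < _ by omega) ht (by omega)).ne'

variable [Fintype E]

theorem sum_stepSign_le_of_descent {d : E} (hd : θ (f d) < θ d) :
    ∑ e ∈ cycleFinset f d, stepSign f θ e ≤ (cycleFinset f d).card - 2 ∧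
      (∑ e ∈ cycleFinset f d, stepSign f θ e = (cycleFinset f d).card - 2 →
        IncreasesFrom f θ (f d)) := by
  classical
  have hmem : d ∈ cycleFinset f d := mem_cycleFinset.2 (Equiv.Perm.SameCycle.refl f d)
  have hdefect : ∑ e ∈ (cycleFinset f d).erase d, (1 - stepSign f θ e) =
      (cycleFinset f d).card - 2 - ∑ e ∈ cycleFinset f d, stepSign f θ e := by
    have herase := Finset.sum_erase_add (f := fun e => 1 - stepSign f θ e) _ hmem
    simp only [stepSign_of_gt hd, Finset.sum_sub_distrib (s := cycleFinset f d), Finset.sum_const,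
      nsmul_eq_mul, mul_one] at herase
    linarith
  have hnonneg : ∀ e ∈ (cycleFinset f d).erase d, 0 ≤ 1 - stepSign f θ e := fun e _ =>
    sub_nonneg.2 (stepSign_le_one f θ e)
  refine ⟨by linarith [Finset.sum_nonneg hnonneg], fun heq => ?_⟩
  rw [heq, sub_self, Finset.sum_eq_zero_iff_of_nonneg hnonneg] at hdefect
  refine increasesFrom_of_single_descent fun e he hed => stepSign_eq_one.1 ?_
  linarith [hdefect e (Finset.mem_erase.2 ⟨hed, mem_cycleFinset.2 he⟩)]

theorem sum_stepSign_of_increasesFrom {m : E} (hm : f m ≠ m) (h : IncreasesFrom f θ m) :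
    ∑ e ∈ cycleFinset f m, stepSign f θ e = (cycleFinset f m).card - 2 := by
  have htwo := two_le_minimalPeriod hm
  obtain ⟨n, hn⟩ : ∃ n, Function.minimalPeriod f m = n + 1 :=
    ⟨_, (Nat.sub_add_cancel (by omega)).symm⟩
  have hlast : θ (f ((f ^ n) m)) < θ ((f ^ n) m) := by
    rw [← pow_succ_perm_apply, ← hn, pow_minimalPeriod_apply]
    exact h (show 0 < _ by omega) (show n < _ by omega) (by omega)
  have hascent : ∀ k ∈ Finset.range n, stepSign f θ ((f ^ k) m) = 1 := fun k hk => by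
    rw [Finset.mem_range] at hk
    rw [stepSign_eq_one, ← pow_succ_perm_apply]
    exact h (show k < _ by omega) (show k + 1 < _ by omega) k.lt_succ_self
  rw [card_cycleFinset, ← sum_range_minimalPeriod, hn, Finset.sum_range_succ,
    Finset.sum_congr rfl hascent, stepSign_of_gt hlast]
  simp only [Finset.sum_const, Finset.card_range, nsmul_eq_mul, Nat.cast_add]
  ring

theorem sum_stepSign_le (θ : E → α) {e : E} (he : f e ≠ e) :
    ∑ e' ∈ cycleFinset f e, stepSign f θ e' ≤ (cycleFinset f e).card - 2 := by
  by_cases h : ∀ e', f.SameCycle e e' → θ e' ≤ θ (f e')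
  · rw [Finset.sum_eq_zero fun e' he' =>
      stepSign_eq_zero.2 (eq_of_no_descent h (mem_cycleFinset.1 he')), card_cycleFinset]
    exact sub_nonneg.2 (mod_cast two_le_minimalPeriod he)
  · push Not at h
    obtain ⟨d, hed, hd⟩ := h
    rw [cycleFinset_eq_of_sameCycle hed]
    exact (sum_stepSign_le_of_descent hd).1

theorem sum_stepSign_eq_iff {e : E} (he : f e ≠ e) :
    ∑ e' ∈ cycleFinset f e, stepSign f θ e' = (cycleFinset f e).card - 2 ↔
      (∃ m, f.SameCycle e m ∧ IncreasesFrom f θ m) ∨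
        ((∀ e', f.SameCycle e e' → θ (f e') = θ e') ∧ (cycleFinset f e).card = 2) := by
  have hzero : (∀ e', f.SameCycle e e' → θ (f e') = θ e') →
      ∑ e' ∈ cycleFinset f e, stepSign f θ e' = 0 := fun h =>
    Finset.sum_eq_zero fun e' he' => stepSign_eq_zero.2 (h e' (mem_cycleFinset.1 he'))
  constructor
  · intro hsum
    by_cases h : ∀ e', f.SameCycle e e' → θ e' ≤ θ (f e')
    · have hconst := fun e' he' => eq_of_no_descent h (e' := e') he'
      rw [hzero hconst] at hsum
      exact Or.inr ⟨hconst, by omega⟩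
    · push Not at h
      obtain ⟨d, hed, hd⟩ := h
      rw [cycleFinset_eq_of_sameCycle hed] at hsum
      exact Or.inl ⟨f d, Equiv.Perm.sameCycle_apply_right.2 hed,
        (sum_stepSign_le_of_descent hd).2 hsum⟩
  · rintro (⟨m, hem, hm⟩ | ⟨hconst, hcard⟩)
    · rw [cycleFinset_eq_of_sameCycle hem]
      exact sum_stepSign_of_increasesFrom (fun h => he (hem.apply_eq_self_iff.2 h)) hm
    · rw [hzero hconst, hcard, Nat.cast_ofNat, sub_self]

open Classical in
theorem sum_card_cycleFinset_sub_two (f : Equiv.Perm E) :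
    (∑ c : Quotient (Equiv.Perm.SameCycle.setoid f), ((cycleFinset f c.out).card - 2 : ℤ)) =
      Nat.card E - 2 * Nat.card (Quotient (Equiv.Perm.SameCycle.setoid f)) := by
  have hcard := sum_sum_cycleFinset f fun _ => (1 : ℤ)
  simp only [Finset.sum_const, nsmul_eq_mul, mul_one, Finset.card_univ] at hcard
  rw [Finset.sum_sub_distrib, hcard]
  simp [Nat.card_eq_fintype_card, mul_comm]

theorem sum_stepSign_univ_le (θ : E → α) (hf : ∀ e, f e ≠ e) :
    ∑ e, stepSign f θ e ≤
      Nat.card E - 2 * Nat.card (Quotient (Equiv.Perm.SameCycle.setoid f)) := by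
  classical
  rw [← sum_card_cycleFinset_sub_two, ← sum_sum_cycleFinset f]
  exact Finset.sum_le_sum fun c _ => sum_stepSign_le θ (hf c.out)

/-- Around every cycle of `f`, the number of ascents of `θ` minus the number of descents is two less
than the length.  By `sum_stepSign_le` this is the maximum if `f` has no fixed points. -/
def HasMaximalAscent (f : Equiv.Perm E) (θ : E → α) : Prop :=
  ∀ e, ∑ e' ∈ cycleFinset f e, stepSign f θ e' = (cycleFinset f e).card - 2

theorem HasMaximalAscent.apply_eq (h : HasMaximalAscent f θ) {e : E} (hf : f e ≠ e)
    (he : θ (f e) = θ e) : θ (f (f e)) = θ (f e) := by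
  rcases (sum_stepSign_eq_iff hf).1 (h e) with ⟨m, hem, hm⟩ | ⟨hconst, -⟩
  · exact absurd he.symm (hm.apply_ne hem.symm hf)
  · exact hconst _ (Equiv.Perm.sameCycle_apply_right.2 (Equiv.Perm.SameCycle.refl f e))

theorem sum_stepSign_univ_eq_iff (θ : E → α) (hf : ∀ e, f e ≠ e) :
    ∑ e, stepSign f θ e =
        Nat.card E - 2 * Nat.card (Quotient (Equiv.Perm.SameCycle.setoid f)) ↔
      HasMaximalAscent f θ := by
  classical
  rw [← sum_card_cycleFinset_sub_two, ← sum_sum_cycleFinset f,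
    Finset.sum_eq_sum_iff_of_le fun c _ => sum_stepSign_le θ (hf c.out)]
  refine ⟨fun h e => ?_, fun h c _ => h c.out⟩
  rw [← cycleFinset_eq_of_sameCycle (Quotient.mk_out (s := Equiv.Perm.SameCycle.setoid f) e)]
  exact h (Quotient.mk _ e) (Finset.mem_univ _)

end StepSign

end Cycles

section CircularOrder

theorem sbtw_coe_of_lt_of_lt {x y z : ℝ} (hxy : x < y) (hyz : y < z) (hzx : z < x + 2 * Real.pi) :
    sbtw (x : Real.Angle) (y : Real.Angle) (z : Real.Angle) := by
  have hpi : 0 < 2 * Real.pi := Real.two_pi_pos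
  have : Fact (0 < 2 * Real.pi) := ⟨hpi⟩
  have hbtw : btw (z : Real.Angle) (y : Real.Angle) (x : Real.Angle) ↔
      toIcoMod hpi z y ≤ toIocMod hpi z x := QuotientAddGroup.btw_coe_iff
  have hy : toIcoMod hpi z y = y + 2 * Real.pi := by
    rw [← toIcoMod_add_right hpi, toIcoMod_eq_self hpi]
    constructor <;> linarith
  have hx : toIocMod hpi z x = x + 2 * Real.pi := by
    rw [← toIocMod_add_right hpi, toIocMod_eq_self hpi]
    constructor <;> linarith
  rw [sbtw_iff_not_btw, hbtw, hx, hy]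
  linarith

theorem coe_angle_inj_of_mem_Ioc {x y : ℝ} (hx : x ∈ Set.Ioc (-Real.pi) Real.pi)
    (hy : y ∈ Set.Ioc (-Real.pi) Real.pi) : (x : Real.Angle) = y ↔ x = y := by
  refine ⟨fun h => ?_, congrArg _⟩
  rw [← Real.Angle.toReal_coe_eq_self_iff_mem_Ioc.2 hx, h,
    Real.Angle.toReal_coe_eq_self_iff_mem_Ioc.2 hy]

theorem sbtw_coe_angle_iff {x y z : ℝ} (hx : x ∈ Set.Ioc (-Real.pi) Real.pi)
    (hy : y ∈ Set.Ioc (-Real.pi) Real.pi) (hz : z ∈ Set.Ioc (-Real.pi) Real.pi) :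
    sbtw (x : Real.Angle) (y : Real.Angle) (z : Real.Angle) ↔
      (x < y ∧ y < z) ∨ (y < z ∧ z < x) ∨ (z < x ∧ x < y) := by
  obtain ⟨hx1, hx2⟩ := hx
  obtain ⟨hy1, hy2⟩ := hy
  obtain ⟨hz1, hz2⟩ := hz
  have : Fact (0 < 2 * Real.pi) := ⟨Real.two_pi_pos⟩
  constructor
  · intro h
    have hne : x ≠ y ∧ y ≠ z ∧ z ≠ x :=
      ⟨fun h' => sbtw_irrefl_left (h' ▸ h), fun h' => sbtw_irrefl_right (h' ▸ h),
        fun h' => sbtw_irrefl_left_right (h' ▸ h)⟩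
    by_contra hcyc
    have hrev : (z < y ∧ y < x) ∨ (y < x ∧ x < z) ∨ (x < z ∧ z < y) := by grind
    refine sbtw_asymm h ?_
    rcases hrev with ⟨h1, h2⟩ | ⟨h1, h2⟩ | ⟨h1, h2⟩
    · exact sbtw_coe_of_lt_of_lt h1 h2 (by linarith)
    · exact (sbtw_coe_of_lt_of_lt h1 h2 (by linarith)).cyclic_right
    · exact (sbtw_coe_of_lt_of_lt h1 h2 (by linarith)).cyclic_left
  · rintro (⟨h1, h2⟩ | ⟨h1, h2⟩ | ⟨h1, h2⟩)
    · exact sbtw_coe_of_lt_of_lt h1 h2 (by linarith)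
    · exact (sbtw_coe_of_lt_of_lt h1 h2 (by linarith)).cyclic_right
    · exact (sbtw_coe_of_lt_of_lt h1 h2 (by linarith)).cyclic_left

variable {E : Type*} [Finite E] {f : Equiv.Perm E} {θ : E → ℝ}

theorem IncreasesFrom.sbtw_coe (hθ : ∀ e, θ e ∈ Set.Ioc (-Real.pi) Real.pi) {m e : E}
    (h : IncreasesFrom f θ m) (he : f.SameCycle m e) {i j : ℕ} (hi : 0 < i) (hij : i < j)
    (hj : j < Function.minimalPeriod f e) :
    sbtw (θ e : Real.Angle) (θ ((f ^ i) e) : Real.Angle) (θ ((f ^ j) e) : Real.Angle) := by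
  rw [minimalPeriod_eq_of_sameCycle he] at hj
  obtain ⟨t, ht, rfl⟩ := exists_pow_lt_minimalPeriod_eq he
  have hadd : ∀ k, (f ^ k) ((f ^ t) m) = (f ^ (t + k)) m := fun k => by
    rw [← Equiv.Perm.mul_apply, ← pow_add, add_comm]
  have hlt : ∀ a b, a < b → b < Function.minimalPeriod f m → θ ((f ^ a) m) < θ ((f ^ b) m) :=
    fun a b hab hb => h (hab.trans hb) hb hab
  rw [sbtw_coe_angle_iff (hθ _) (hθ _) (hθ _), hadd, hadd]
  rcases lt_or_ge (t + j) (Function.minimalPeriod f m) with hj' | hj'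
  · exact Or.inl ⟨hlt _ _ (by omega) (by omega), hlt _ _ (by omega) hj'⟩
  · rw [← pow_sub_minimalPeriod_apply hj']
    rcases lt_or_ge (t + i) (Function.minimalPeriod f m) with hi' | hi'
    · exact Or.inr (Or.inr ⟨hlt _ _ (by omega) ht, hlt _ _ (by omega) hi'⟩)
    · rw [← pow_sub_minimalPeriod_apply hi']
      exact Or.inr (Or.inl ⟨hlt _ _ (by omega) (by omega), hlt _ _ (by omega) ht⟩)

theorem exists_increasesFrom_of_sbtw_coe (hθ : ∀ e, θ e ∈ Set.Ioc (-Real.pi) Real.pi) {e : E}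
    (hne : ∀ e', f.SameCycle e e' → (θ e' : Real.Angle) ≠ θ (f e'))
    (hsbtw : ∀ e', f.SameCycle e e' → ∀ i j : ℕ, 0 < i → i < j → j < Function.minimalPeriod f e' →
      sbtw (θ e' : Real.Angle) (θ ((f ^ i) e') : Real.Angle) (θ ((f ^ j) e') : Real.Angle)) :
    ∃ m, f.SameCycle e m ∧ IncreasesFrom f θ m := by
  obtain ⟨m, hem, hmin⟩ := {e' | f.SameCycle e e'}.toFinite.exists_minimalFor θ _
    ⟨e, Equiv.Perm.SameCycle.refl f e⟩
  have hle : ∀ k : ℕ, θ m ≤ θ ((f ^ k) m) := fun k =>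
    not_lt.1 fun hlt => hlt.not_ge (hmin (Equiv.Perm.sameCycle_pow_right.2 hem) hlt.le)
  refine ⟨m, hem, strictMonoOn_of_lt_add_one Set.ordConnected_Iio fun i _ _ hi => ?_⟩
  rcases i.eq_zero_or_pos with rfl | hpos
  · refine lt_of_le_of_ne (by simpa using hle 1) fun heq => hne m hem ?_
    simpa using congrArg ((↑) : ℝ → Real.Angle) heq
  · rcases (sbtw_coe_angle_iff (hθ _) (hθ _) (hθ _)).1
      (hsbtw m hem i (i + 1) hpos i.lt_succ_self hi) with h | h | h
    · exact h.2
    · exact absurd h.2 (hle _).not_gt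
    · exact absurd h.1 (hle _).not_gt

end CircularOrder

section LinearAlgebra

theorem exists_vecMul_eq_of_orthogonal {K m n : Type*} [Field K] [Fintype m] [Fintype n]
    (M : Matrix m n K) (x : n → K) (h : ∀ z, M.mulVec z = 0 → x ⬝ᵥ z = 0) :
    ∃ g : m → K, Matrix.vecMul g M = x := by
  classical
  have hmem : dotProductEquiv K n x ∈ M.mulVecLin.ker.dualAnnihilator :=
    (Submodule.mem_dualAnnihilator _).2 fun z hz => h z (LinearMap.mem_ker.1 hz)
  rw [← LinearMap.range_dualMap_eq_dualAnnihilator_ker] at hmem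
  obtain ⟨ψ, hψ⟩ := hmem
  obtain ⟨g, rfl⟩ := (dotProductEquiv K m).surjective ψ
  refine ⟨g, dotProduct_eq _ _ fun z => ?_⟩
  rw [← Matrix.dotProduct_mulVec]
  exact LinearMap.congr_fun hψ z

end LinearAlgebra

section Potential

variable {E M : Type*} [AddCommGroup M]

theorem sum_comp_sub_eq_zero [Fintype E] (σ : Equiv.Perm E) (u : E → M) :
    ∑ e, (u (σ e) - u e) = 0 := by
  rw [Finset.sum_sub_distrib, Equiv.sum_comp σ u, sub_self]

theorem sum_range_eq_of_pow_apply_eq [Fintype E] {f : Equiv.Perm E} {h : E → M} {e : E}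
    (hsum : ∑ e' ∈ cycleFinset f e, h e' = 0) {k l : ℕ} (hkl : (f ^ k) e = (f ^ l) e) :
    ∑ i ∈ Finset.range k, h ((f ^ i) e) = ∑ i ∈ Finset.range l, h ((f ^ i) e) := by
  have hperiodic : Function.Periodic (fun k => ∑ i ∈ Finset.range k, h ((f ^ i) e))
      (Function.minimalPeriod f e) := fun k => by
    have hpow : ∀ i, (f ^ (Function.minimalPeriod f e + i)) e = (f ^ i) e := fun i => by
      rw [← pow_sub_minimalPeriod_apply (Nat.le_add_right _ _), Nat.add_sub_cancel_left]
    simp only [add_comm k, Finset.sum_range_add, sum_range_minimalPeriod, hsum, hpow, zero_add]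
  have hpos : 0 < Function.minimalPeriod f e := minimalPeriod_perm_pos f e
  have hmod : k % Function.minimalPeriod f e = l % Function.minimalPeriod f e :=
    Function.iterate_injOn_Iio_minimalPeriod (Nat.mod_lt _ hpos) (Nat.mod_lt _ hpos) (by
      simpa only [Function.iterate_mod_minimalPeriod_eq, Equiv.Perm.coe_pow] using hkl)
  rw [← hperiodic.map_mod_nat k, hmod, hperiodic.map_mod_nat l]

theorem exists_potential [Fintype E] {f : Equiv.Perm E} {h : E → M}
    (hsum : ∀ e, ∑ e' ∈ cycleFinset f e, h e' = 0) : ∃ p : E → M, ∀ e, p (f e) - p e = h e := by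
  let base : E → E := fun e => (Quotient.mk (Equiv.Perm.SameCycle.setoid f) e).out
  have hbase : ∀ e, f.SameCycle (base e) e := fun e =>
    Quotient.mk_out (s := Equiv.Perm.SameCycle.setoid f) e
  choose k hk using fun e => (hbase e).exists_nat_pow_eq
  refine ⟨fun e => ∑ i ∈ Finset.range (k e), h ((f ^ i) (base e)), fun e => ?_⟩
  have hbase_apply : base (f e) = base e := congrArg Quotient.out
    (Quotient.sound (s := Equiv.Perm.SameCycle.setoid f)
      (Equiv.Perm.sameCycle_apply_left.2 (Equiv.Perm.SameCycle.refl f e)))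
  have hpow : (f ^ k (f e)) (base e) = (f ^ (k e + 1)) (base e) := by
    rw [pow_succ_perm_apply, hk, ← hbase_apply, hk]
  beta_reduce
  rw [hbase_apply, sum_range_eq_of_pow_apply_eq (hsum _) hpow, Finset.sum_range_succ, hk,
    add_sub_cancel_left]

end Potential

namespace BipartiteMap

section Incidence

variable {E : Type*} {D : BipartiteMap E}

theorem whiteEnd_white (e : E) : D.whiteEnd (D.white e) = D.whiteEnd e :=
  Quotient.sound (s := Equiv.Perm.SameCycle.setoid D.white)
    (Equiv.Perm.sameCycle_apply_left.2 (Equiv.Perm.SameCycle.refl _ _))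

theorem blackEnd_black (e : E) : D.blackEnd (D.black e) = D.blackEnd e :=
  Quotient.sound (s := Equiv.Perm.SameCycle.setoid D.black)
    (Equiv.Perm.sameCycle_apply_left.2 (Equiv.Perm.SameCycle.refl _ _))

theorem leftFace_facePerm (e : E) : D.leftFace (D.facePerm e) = D.leftFace e :=
  Quotient.sound (s := Equiv.Perm.SameCycle.setoid D.facePerm)
    (Equiv.Perm.sameCycle_apply_left.2 (Equiv.Perm.SameCycle.refl _ _))

theorem zigzagOf_zigzagPerm (e : E) : D.zigzagOf (D.zigzagPerm e) = D.zigzagOf e :=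
  Quotient.sound (s := Equiv.Perm.SameCycle.setoid D.zigzagPerm)
    (Equiv.Perm.sameCycle_apply_left.2 (Equiv.Perm.SameCycle.refl _ _))

theorem whiteEnd_eq_iff {e e' : E} : D.whiteEnd e = D.whiteEnd e' ↔ D.white.SameCycle e e' :=
  Quotient.eq (r := Equiv.Perm.SameCycle.setoid D.white)

theorem blackEnd_eq_iff {e e' : E} : D.blackEnd e = D.blackEnd e' ↔ D.black.SameCycle e e' :=
  Quotient.eq (r := Equiv.Perm.SameCycle.setoid D.black)

theorem facePerm_apply (e : E) : D.facePerm e = D.white⁻¹ (D.black⁻¹ e) := rfl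

theorem white_white_inv (e : E) : D.white (D.white⁻¹ e) = e := D.white.apply_symm_apply e

theorem white_inv_white (e : E) : D.white⁻¹ (D.white e) = e := D.white.symm_apply_apply e

theorem black_inv_black (e : E) : D.black⁻¹ (D.black e) = e := D.black.symm_apply_apply e

theorem black_black_inv (e : E) : D.black (D.black⁻¹ e) = e := D.black.apply_symm_apply e

theorem whiteEnd_white_inv (e : E) : D.whiteEnd (D.white⁻¹ e) = D.whiteEnd e := by
  rw [← whiteEnd_white, white_white_inv]

theorem blackEnd_black_inv (e : E) : D.blackEnd (D.black⁻¹ e) = D.blackEnd e := by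
  rw [← blackEnd_black, black_black_inv]

theorem rightFace_eq_leftFace_black (e : E) : D.rightFace e = D.leftFace (D.black e) := rfl

theorem rightFace_white (e : E) : D.rightFace (D.white e) = D.leftFace e := by
  have hface : D.facePerm (D.black (D.white e)) = e :=
    (D.black * D.white).symm_apply_apply e
  rw [rightFace_eq_leftFace_black, ← leftFace_facePerm, hface]

theorem rightFace_black_inv (e : E) : D.rightFace (D.black⁻¹ e) = D.leftFace e := by
  rw [rightFace_eq_leftFace_black, black_black_inv]

theorem zigzagOf_white_inv (e : E) : D.zigzagOf (D.white⁻¹ e) = D.zigzagOf (D.black⁻¹ e) := by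
  rw [← zigzagOf_zigzagPerm, zigzagPerm, Equiv.Perm.mul_apply, white_white_inv]

theorem nonempty_of_connected (hconn : D.graph.Connected) : Nonempty E := by
  obtain ⟨w | b⟩ := hconn.nonempty
  · exact ⟨w.out⟩
  · exact ⟨b.out⟩

theorem edge_induction [Finite E] (hconn : D.graph.Connected) {p : E → Prop}
    (hw : ∀ e, p e → p (D.white e)) (hb : ∀ e, p e → p (D.black e)) {e : E} (he : p e) (e' : E) :
    p e' := by
  have hcycle : ∀ {f : Equiv.Perm E}, (∀ e, p e → p (f e)) → ∀ {e e'}, f.SameCycle e e' →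
      p e → p e' := fun hf _ _ h he => by
    obtain ⟨k, rfl⟩ := h.exists_nat_pow_eq
    exact Set.MapsTo.iterate (s := {e | p e}) hf k he
  let allAt : D.Node → Prop := Sum.elim (fun w => ∀ e, D.whiteEnd e = w → p e)
    fun b => ∀ e, D.blackEnd e = b → p e
  have hwhite : ∀ e, p e → allAt (Sum.inl (D.whiteEnd e)) := fun e he x hx =>
    hcycle hw (whiteEnd_eq_iff.1 hx.symm) he
  have hblack : ∀ e, p e → allAt (Sum.inr (D.blackEnd e)) := fun e he x hx =>
    hcycle hb (blackEnd_eq_iff.1 hx.symm) he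
  have hadj : ∀ u v, D.graph.Adj u v → allAt u → allAt v := by
    rintro _ _ ⟨x, ⟨rfl, rfl⟩ | ⟨rfl, rfl⟩⟩ hu
    · exact hblack x (hu x rfl)
    · exact hwhite x (hu x rfl)
  have hreach : D.graph.Reachable (Sum.inl (D.whiteEnd e)) (Sum.inl (D.whiteEnd e')) :=
    hconn.preconnected _ _
  rw [SimpleGraph.reachable_iff_reflTransGen] at hreach
  exact hreach.rec (motive := fun v _ => allAt v) (hwhite e he) (fun _ h ih => hadj _ _ h ih) e' rfl

end Incidence

section CupProduct

variable {E R : Type*} [CommRing R] {D : BipartiteMap E}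

/-- Cellular 1-cochains `x` that vanish on the boundaries of all faces, together with a function `p`
that develops `x` along these boundaries: `p e` is the value of a primitive of `x`, in the face to
the left of `e`, at the white end of `e`.  On every face `p` is determined up to a constant. -/
def developedCochains (D : BipartiteMap E) (R : Type*) [CommRing R] :
    Submodule R ((E → R) × (E → R)) where
  carrier := {ω | ∀ e, ω.2 (D.facePerm e) - ω.2 e = ω.1 e - ω.1 (D.black⁻¹ e)}
  zero_mem' e := by simp
  add_mem' {ω η} hω hη e := by
    simp only [Prod.fst_add, Prod.snd_add, Pi.add_apply]
    linear_combination hω e + hη e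
  smul_mem' c ω hω e := by
    simp only [Prod.smul_fst, Prod.smul_snd, Pi.smul_apply, smul_eq_mul]
    linear_combination c * hω e

theorem snd_facePerm_of_mem {ω : (E → R) × (E → R)} (hω : ω ∈ D.developedCochains R) (e : E) :
    ω.2 (D.facePerm e) = ω.2 e + (ω.1 e - ω.1 (D.black⁻¹ e)) :=
  eq_add_of_sub_eq' (hω e)

/-- The coboundary of the 0-cochain with values `γ` at the white and `κ` at the black nodes,
developed by its values at the white nodes. -/
def developedCoboundary (γ : D.WhiteNode → R) (κ : D.BlackNode → R) : (E → R) × (E → R) :=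
  (fun e => κ (D.blackEnd e) - γ (D.whiteEnd e), fun e => γ (D.whiteEnd e))

theorem developedCoboundary_mem (γ : D.WhiteNode → R) (κ : D.BlackNode → R) :
    developedCoboundary γ κ ∈ D.developedCochains R := fun e => by
  simp only [developedCoboundary, facePerm_apply, whiteEnd_white_inv, blackEnd_black_inv]
  ring

open Classical in
/-- The indicator function of the edges that a zigzag path traverses from black to white. -/
noncomputable def onZigzag (Z : D.Zigzag) (e : E) : ℤ := if D.zigzagOf e = Z then 1 else 0

theorem onZigzag_white_inv (Z : D.Zigzag) (e : E) :
    onZigzag Z (D.white⁻¹ e) = onZigzag Z (D.black⁻¹ e) := by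
  rw [onZigzag, onZigzag, zigzagOf_white_inv]

/-- The 1-chain of a zigzag path; edges are oriented from white to black. -/
noncomputable def zigzagChain (Z : D.Zigzag) (e : E) : ℤ := onZigzag Z (D.white⁻¹ e) - onZigzag Z e

/-- The Poincaré dual of a zigzag path: the path is pushed off the graph so that it has the white
nodes on its left, and then crosses exactly the edges that it traverses, always in the same
direction.  The developing function counts the crossings of a face boundary. -/
noncomputable def zigzagDual (R : Type*) [CommRing R] (Z : D.Zigzag) : (E → R) × (E → R) :=
  (fun e => onZigzag Z e + onZigzag Z (D.white⁻¹ e), fun e => -onZigzag Z e)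

theorem zigzagDual_mem (Z : D.Zigzag) : zigzagDual R Z ∈ D.developedCochains R := fun e => by
  simp only [zigzagDual, facePerm_apply, onZigzag_white_inv Z e]
  ring

/-- The contribution of the edge `e` to the cup product: if `ω` and `η` are the two coordinates of a
developing map, this is the shoelace term of the two steps along `e` and `black⁻¹ e` of the boundary
of the face to the left of `e`. -/
def cupDensity (D : BipartiteMap E) (ω η : (E → R) × (E → R)) (e : E) : R :=
  ω.2 e * (η.1 e - η.1 (D.black⁻¹ e)) - η.2 e * (ω.1 e - ω.1 (D.black⁻¹ e)) -
    (ω.1 e * η.1 (D.black⁻¹ e) - η.1 e * ω.1 (D.black⁻¹ e))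

variable [Fintype E]

/-- Twice the cup product of two developed 1-cochains, evaluated on the fundamental class. -/
def cupForm (D : BipartiteMap E) (R : Type*) [CommRing R] :
    LinearMap.BilinForm R ((E → R) × (E → R)) :=
  LinearMap.mk₂ R (fun ω η => ∑ e, D.cupDensity ω η e)
    (fun ω ω' η => by
      rw [← Finset.sum_add_distrib]
      refine Finset.sum_congr rfl fun e _ => ?_
      simp only [cupDensity, Prod.fst_add, Prod.snd_add, Pi.add_apply]
      ring)
    (fun c ω η => by
      rw [smul_eq_mul, Finset.mul_sum]
      refine Finset.sum_congr rfl fun e _ => ?_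
      simp only [cupDensity, Prod.smul_fst, Prod.smul_snd, Pi.smul_apply, smul_eq_mul]
      ring)
    (fun ω η η' => by
      rw [← Finset.sum_add_distrib]
      refine Finset.sum_congr rfl fun e _ => ?_
      simp only [cupDensity, Prod.fst_add, Prod.snd_add, Pi.add_apply]
      ring)
    (fun c ω η => by
      rw [smul_eq_mul, Finset.mul_sum]
      refine Finset.sum_congr rfl fun e _ => ?_
      simp only [cupDensity, Prod.smul_fst, Prod.smul_snd, Pi.smul_apply, smul_eq_mul]
      ring)

theorem cupForm_apply (ω η : (E → R) × (E → R)) :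
    D.cupForm R ω η = ∑ e, D.cupDensity ω η e := rfl

theorem cupForm_isAlt : (D.cupForm R).IsAlt := fun ω => by
  rw [cupForm_apply]
  exact Finset.sum_eq_zero fun e _ => by rw [cupDensity]; ring

theorem sum_eq_of_telescoping {F G : E → R} (σ τ : Equiv.Perm E) (u v : E → R)
    (h : ∀ e, F e = G e + (u (σ e) - u e) + (v (τ e) - v e)) : ∑ e, F e = ∑ e, G e := by
  rw [Finset.sum_congr rfl fun e _ => h e, Finset.sum_add_distrib, Finset.sum_add_distrib,
    sum_comp_sub_eq_zero, sum_comp_sub_eq_zero, add_zero, add_zero]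

theorem cupForm_eq_zero_of_fst_eq_zero {ω η : (E → R) × (E → R)} (hω : ω ∈ D.developedCochains R)
    (hη : η ∈ D.developedCochains R) (h : ω.1 = 0) : D.cupForm R ω η = 0 := by
  rw [cupForm_apply, ← sum_comp_sub_eq_zero D.facePerm fun e => ω.2 e * η.2 e]
  refine Finset.sum_congr rfl fun e _ => ?_
  rw [snd_facePerm_of_mem hω, snd_facePerm_of_mem hη, cupDensity, h]
  simp only [Pi.zero_apply]
  ring

theorem cupForm_developedCoboundary_left (γ : D.WhiteNode → R) (κ : D.BlackNode → R)
    {η : (E → R) × (E → R)} (hη : η ∈ D.developedCochains R) :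
    D.cupForm R (developedCoboundary γ κ) η = 0 := by
  rw [cupForm_apply, ← Finset.sum_const_zero (ι := E) (s := Finset.univ)]
  refine sum_eq_of_telescoping D.facePerm D.black⁻¹ (fun e => -(γ (D.whiteEnd e) * η.2 e))
    (fun e => -((κ (D.blackEnd e) + γ (D.whiteEnd e)) * η.1 e)) fun e => ?_
  rw [snd_facePerm_of_mem hη, facePerm_apply, whiteEnd_white_inv, cupDensity]
  simp only [developedCoboundary, blackEnd_black_inv]
  ring

theorem cupForm_zigzagDual_left (Z : D.Zigzag) {η : (E → R) × (E → R)}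
    (hη : η ∈ D.developedCochains R) :
    D.cupForm R (zigzagDual R Z) η = 2 * ∑ e, (zigzagChain Z e : R) * η.1 e := by
  rw [cupForm_apply, Finset.mul_sum]
  refine sum_eq_of_telescoping D.facePerm D.black⁻¹ (fun e => onZigzag Z e * η.2 e)
    (fun e => (onZigzag Z (D.white⁻¹ e) - onZigzag Z e) * η.1 e) fun e => ?_
  rw [snd_facePerm_of_mem hη, cupDensity]
  simp only [zigzagDual, zigzagChain, facePerm_apply, onZigzag_white_inv Z e]
  push_cast
  ring

end CupProduct

section FaceBoundary

variable {E : Type*} {D : BipartiteMap E}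

/-- The rational cellular boundary map from 2-chains to 1-chains. -/
def faceBoundary (D : BipartiteMap E) : (D.Face → ℚ) →ₗ[ℚ] (E → ℚ) :=
  LinearMap.funLeft ℚ ℚ D.leftFace - LinearMap.funLeft ℚ ℚ D.rightFace

theorem faceBoundary_apply (c : D.Face → ℚ) (e : E) :
    D.faceBoundary c e = c (D.leftFace e) - c (D.rightFace e) := rfl

theorem dotProduct_faceBoundary [Fintype E] {ω : (E → ℚ) × (E → ℚ)}
    (hω : ω ∈ D.developedCochains ℚ) (c : D.Face → ℚ) : ω.1 ⬝ᵥ D.faceBoundary c = 0 := by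
  rw [dotProduct, ← Finset.sum_const_zero (ι := E) (s := Finset.univ)]
  refine sum_eq_of_telescoping D.facePerm D.black⁻¹ (fun e => c (D.leftFace e) * ω.2 e)
    (fun e => c (D.rightFace e) * ω.1 e) fun e => ?_
  rw [snd_facePerm_of_mem hω, leftFace_facePerm, rightFace_black_inv, faceBoundary_apply]
  ring

theorem ker_faceBoundary [Finite E] (hconn : D.graph.Connected) :
    LinearMap.ker D.faceBoundary = Submodule.span ℚ {1} := by
  obtain ⟨e₀⟩ := nonempty_of_connected hconn
  ext c
  rw [LinearMap.mem_ker, Submodule.mem_span_singleton]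
  constructor
  · intro hc
    have hleft : ∀ e, c (D.leftFace e) = c (D.rightFace e) := fun e =>
      sub_eq_zero.1 (congrFun hc e)
    have hconst : ∀ e, c (D.leftFace e) = c (D.leftFace e₀) :=
      edge_induction hconn (fun e he => by rw [hleft, rightFace_white, he])
        (fun e he => by rw [← rightFace_eq_leftFace_black, ← hleft, he]) rfl
    refine ⟨c (D.leftFace e₀), funext fun f => ?_⟩
    obtain ⟨e, rfl⟩ : ∃ e, D.leftFace e = f := Quotient.exists_rep f
    rw [Pi.smul_apply, Pi.one_apply, smul_eq_mul, mul_one, hconst e]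
  · rintro ⟨a, rfl⟩
    ext e
    rw [faceBoundary_apply]
    exact sub_self _

end FaceBoundary

/-- The two coordinates of a winding number or displacement, as rational numbers. -/
def coord : Fin 2 → (ℤ × ℤ →+ ℚ) :=
  ![(Int.castAddHom ℚ).comp (AddMonoidHom.fst ℤ ℤ), (Int.castAddHom ℚ).comp (AddMonoidHom.snd ℤ ℤ)]

theorem coord_zero (v : ℤ × ℤ) : coord 0 v = v.1 := rfl

theorem coord_one (v : ℤ × ℤ) : coord 1 v = v.2 := rfl

theorem coord_zsmul (i : Fin 2) (n : ℤ) (v : ℤ × ℤ) : coord i (n • v) = n * coord i v := by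
  rw [map_zsmul, zsmul_eq_mul]

theorem facePos_succ {E : Type*} (D : BipartiteMap E) (disp : E → ℤ × ℤ) (e : E) (k : ℕ) :
    D.facePos disp e (k + 1) = D.facePos disp e k +
      (disp ((D.facePerm ^ k) e) - disp (D.black⁻¹ ((D.facePerm ^ k) e))) :=
  Finset.sum_range_succ _ _

namespace TorusMarking

variable {E : Type*} [Fintype E] {D : BipartiteMap E}

theorem sum_cycleFinset_facePerm (T : D.TorusMarking) (e : E) :
    ∑ e' ∈ cycleFinset D.facePerm e, (T.disp e' - T.disp (D.black⁻¹ e')) = 0 := by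
  rw [← filter_mk_sameCycle_eq]
  exact T.face_closed (D.leftFace e)

theorem sum_coord_cycleFinset_facePerm (T : D.TorusMarking) (i : Fin 2) (e : E) :
    ∑ e' ∈ cycleFinset D.facePerm e,
      (coord i (T.disp e') - coord i (T.disp (D.black⁻¹ e'))) = 0 := by
  simp only [← map_sub, ← map_sum, sum_cycleFinset_facePerm, map_zero]

/-- The `i`-th coordinate of the displacement, as a developed cochain. -/
noncomputable def developedCoord (T : D.TorusMarking) (i : Fin 2) : (E → ℚ) × (E → ℚ) :=
  (fun e => coord i (T.disp e), (exists_potential (T.sum_coord_cycleFinset_facePerm i)).choose)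

theorem developedCoord_mem (T : D.TorusMarking) (i : Fin 2) :
    T.developedCoord i ∈ D.developedCochains ℚ :=
  (exists_potential (T.sum_coord_cycleFinset_facePerm i)).choose_spec

theorem coord_facePos (T : D.TorusMarking) (i : Fin 2) (e : E) (k : ℕ) :
    coord i (D.facePos T.disp e k) =
      (T.developedCoord i).2 ((D.facePerm ^ k) e) - (T.developedCoord i).2 e := by
  have htelescope := Finset.sum_range_sub (fun k => (T.developedCoord i).2 ((D.facePerm ^ k) e)) k
  simp only [pow_zero, Equiv.Perm.one_apply, pow_succ_perm_apply, T.developedCoord_mem i _]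
    at htelescope
  rw [facePos, map_sum, ← htelescope]
  exact Finset.sum_congr rfl fun j _ => map_sub _ _ _

theorem faceArea₂_eq_sum_cupDensity (T : D.TorusMarking) (e : E) :
    (D.faceArea₂ T.disp e : ℚ) = ∑ e' ∈ cycleFinset D.facePerm e,
      D.cupDensity (T.developedCoord 0) (T.developedCoord 1) e' := by
  let step (i : Fin 2) (e' : E) : ℚ := coord i (T.disp e') - coord i (T.disp (D.black⁻¹ e'))
  have hshift : ∑ e' ∈ cycleFinset D.facePerm e,
      (D.cupDensity (T.developedCoord 0) (T.developedCoord 1) e' -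
        ((T.developedCoord 0).2 e * step 1 e' - (T.developedCoord 1).2 e * step 0 e')) =
      ∑ e' ∈ cycleFinset D.facePerm e,
        D.cupDensity (T.developedCoord 0) (T.developedCoord 1) e' := by
    rw [Finset.sum_sub_distrib, Finset.sum_sub_distrib, ← Finset.mul_sum, ← Finset.mul_sum]
    simp only [step, sum_coord_cycleFinset_facePerm, mul_zero, sub_zero]
  rw [← hshift, ← sum_range_minimalPeriod, faceArea₂, Int.cast_sum]
  refine Finset.sum_congr rfl fun k _ => ?_
  have hx := T.coord_facePos 0 e k
  have hy := T.coord_facePos 1 e k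
  rw [coord_zero] at hx
  rw [coord_one] at hy
  simp only [facePos_succ, wedge, Prod.fst_add, Prod.snd_add, Prod.fst_sub, Prod.snd_sub,
    Int.cast_add, Int.cast_sub, Int.cast_mul, hx, hy, cupDensity, step, developedCoord, coord_zero,
    coord_one]
  ring

theorem cupForm_developedCoord (T : D.TorusMarking) :
    D.cupForm ℚ (T.developedCoord 0) (T.developedCoord 1) = 2 := by
  classical
  rw [cupForm_apply, ← sum_sum_cycleFinset D.facePerm]
  simp only [← faceArea₂_eq_sum_cupDensity]
  rw [← Int.cast_sum]
  exact_mod_cast T.degree_one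

section BoundaryMatrix

open Classical in
/-- Developed cochains which span all developed cochains up to cochains that vanish on every edge:
the coboundaries of the single nodes and the two coordinates of the displacement. -/
noncomputable def generator (T : D.TorusMarking) : D.Node ⊕ Fin 2 → (E → ℚ) × (E → ℚ) :=
  Sum.elim (Sum.elim (fun w => developedCoboundary (Pi.single w 1) 0)
    fun b => developedCoboundary 0 (Pi.single b 1)) T.developedCoord

theorem generator_mem (T : D.TorusMarking) (r : D.Node ⊕ Fin 2) :
    T.generator r ∈ D.developedCochains ℚ := by
  obtain (w | b) | i := r
  · exact developedCoboundary_mem _ _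
  · exact developedCoboundary_mem _ _
  · exact T.developedCoord_mem i

/-- The matrix that maps a 1-chain to its boundary and its total displacement. -/
noncomputable def boundaryMatrix (T : D.TorusMarking) : Matrix (D.Node ⊕ Fin 2) E ℚ :=
  Matrix.of fun r => (T.generator r).1

theorem boundaryMatrix_mulVec_faceBoundary (T : D.TorusMarking) (c : D.Face → ℚ) :
    T.boundaryMatrix.mulVec (D.faceBoundary c) = 0 :=
  funext fun r => dotProduct_faceBoundary (T.generator_mem r) c

open Classical in
theorem boundaryMatrix_mulVec_intCast (T : D.TorusMarking) (z : E → ℤ) :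
    T.boundaryMatrix.mulVec (fun e => (z e : ℚ)) =
      Sum.elim (Sum.elim (fun w => ((-∑ e with D.whiteEnd e = w, z e : ℤ) : ℚ))
        fun b => ((∑ e with D.blackEnd e = b, z e : ℤ) : ℚ))
        fun i => coord i (∑ e, z e • T.disp e) := by
  ext ((w | b) | i)
  · simp [boundaryMatrix, generator, developedCoboundary, Matrix.mulVec, dotProduct,
      Pi.single_apply, Finset.sum_filter]
  · simp [boundaryMatrix, generator, developedCoboundary, Matrix.mulVec, dotProduct,
      Pi.single_apply, Finset.sum_filter]
  · simp [boundaryMatrix, generator, developedCoord, Matrix.mulVec, dotProduct, map_sum,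
      coord_zsmul, mul_comm, -zsmul_eq_mul]

theorem boundaryMatrix_mulVec_intCast_eq_zero (T : D.TorusMarking) {z : E → ℤ}
    (hz : T.boundaryMatrix.mulVec (fun e => (z e : ℚ)) = 0) :
    D.IsCycle z ∧ ∑ e, z e • T.disp e = 0 := by
  rw [boundaryMatrix_mulVec_intCast] at hz
  refine ⟨⟨fun w => ?_, fun b => ?_⟩, Prod.ext ?_ ?_⟩
  · exact neg_eq_zero.1 (Int.cast_eq_zero.1 (congrFun hz (Sum.inl (Sum.inl w))))
  · exact Int.cast_eq_zero.1 (congrFun hz (Sum.inl (Sum.inr b)))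
  · exact Int.cast_eq_zero.1 (congrFun hz (Sum.inr 0))
  · exact Int.cast_eq_zero.1 (congrFun hz (Sum.inr 1))

theorem exists_faceBoundary_eq (T : D.TorusMarking) {z : E → ℚ}
    (hz : T.boundaryMatrix.mulVec z = 0) : ∃ c, D.faceBoundary c = z := by
  obtain ⟨b, hb⟩ := IsLocalization.exist_integer_multiples_of_finite (nonZeroDivisors ℤ) z
  choose z' hz' using hb
  have hb0 : (b : ℤ) ≠ 0 := nonZeroDivisors.ne_zero b.2
  have hclear : (fun e => (z' e : ℚ)) = (b : ℤ) • z := funext hz'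
  obtain ⟨hcyc, hdisp⟩ := T.boundaryMatrix_mulVec_intCast_eq_zero (z := z') (by
    rw [hclear, Matrix.mulVec_smul, hz, smul_zero])
  obtain ⟨c, hc⟩ := T.homology_injective z' hcyc hdisp
  have hboundary : D.faceBoundary (fun f => (c f : ℚ)) = (b : ℤ) • z := by
    rw [← hclear]
    ext e
    rw [faceBoundary_apply, hc, Int.cast_sub]
  refine ⟨((b : ℤ) : ℚ)⁻¹ • fun f => (c f : ℚ), ?_⟩
  rw [map_smul, hboundary, ← Int.cast_smul_eq_zsmul ℚ, inv_smul_smul₀ (Int.cast_ne_zero.2 hb0)]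

theorem ker_boundaryMatrix (T : D.TorusMarking) :
    LinearMap.ker T.boundaryMatrix.mulVecLin = LinearMap.range D.faceBoundary := by
  ext z
  refine ⟨T.exists_faceBoundary_eq, ?_⟩
  rintro ⟨c, rfl⟩
  exact T.boundaryMatrix_mulVec_faceBoundary c

end BoundaryMatrix

section IntersectionNumber

variable {ω η : (E → ℚ) × (E → ℚ)}

theorem exists_cupForm_eq (T : D.TorusMarking) (hω : ω ∈ D.developedCochains ℚ) :
    ∃ a : Fin 2 → ℚ, ∀ η ∈ D.developedCochains ℚ,
      D.cupForm ℚ ω η = ∑ i, a i * D.cupForm ℚ (T.developedCoord i) η := by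
  classical
  obtain ⟨g, hg⟩ := exists_vecMul_eq_of_orthogonal T.boundaryMatrix ω.1 fun z hz => by
    obtain ⟨c, rfl⟩ := T.exists_faceBoundary_eq hz
    exact dotProduct_faceBoundary hω c
  have hmem : ∑ r, g r • T.generator r ∈ D.developedCochains ℚ :=
    Submodule.sum_mem _ fun r _ => Submodule.smul_mem _ _ (T.generator_mem r)
  have hfst : (ω - ∑ r, g r • T.generator r).1 = 0 := by
    rw [Prod.fst_sub, Prod.fst_sum, ← hg, Matrix.vecMul_eq_sum]
    exact sub_self _
  refine ⟨fun i => g (Sum.inr i), fun η hη => ?_⟩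
  have hzero := cupForm_eq_zero_of_fst_eq_zero (Submodule.sub_mem _ hω hmem) hη hfst
  rw [map_sub, LinearMap.sub_apply, sub_eq_zero] at hzero
  rw [hzero, map_sum, LinearMap.sum_apply, Fintype.sum_sum_type, Fintype.sum_sum_type]
  simp only [map_smul, LinearMap.smul_apply, smul_eq_mul, generator, Sum.elim_inl, Sum.elim_inr,
    cupForm_developedCoboundary_left _ _ hη, mul_zero, Finset.sum_const_zero, zero_add]

theorem two_mul_cupForm (T : D.TorusMarking) (hω : ω ∈ D.developedCochains ℚ)
    (hη : η ∈ D.developedCochains ℚ) :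
    2 * D.cupForm ℚ ω η =
      D.cupForm ℚ ω (T.developedCoord 0) * D.cupForm ℚ η (T.developedCoord 1) -
        D.cupForm ℚ ω (T.developedCoord 1) * D.cupForm ℚ η (T.developedCoord 0) := by
  obtain ⟨a, ha⟩ := T.exists_cupForm_eq hω
  have hswap : ∀ i, D.cupForm ℚ (T.developedCoord i) η = -D.cupForm ℚ η (T.developedCoord i) :=
    fun i => (cupForm_isAlt.neg_eq _ _).symm
  have hcoord : D.cupForm ℚ (T.developedCoord 1) (T.developedCoord 0) = -2 := by
    rw [← cupForm_isAlt.neg_eq, cupForm_developedCoord]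
  rw [ha η hη, ha _ (T.developedCoord_mem 0), ha _ (T.developedCoord_mem 1)]
  simp only [Fin.sum_univ_two, hswap, hcoord, cupForm_developedCoord, cupForm_isAlt.self_eq_zero]
  ring

theorem sum_zigzagChain_smul_disp (T : D.TorusMarking) (Z : D.Zigzag) :
    ∑ e, zigzagChain Z e • T.disp e = T.winding Z := by
  classical
  have hcollect : T.winding Z = ∑ e, onZigzag Z e • (T.disp (D.white e) - T.disp e) := by
    simp only [winding, Finset.sum_filter, onZigzag, ite_smul, one_smul, zero_smul]
  rw [hcollect]
  simp only [zigzagChain, sub_smul, smul_sub, Finset.sum_sub_distrib]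
  rw [← Equiv.sum_comp D.white]
  simp only [white_inv_white]

theorem cupForm_zigzagDual_developedCoord (T : D.TorusMarking) (Z : D.Zigzag) (i : Fin 2) :
    D.cupForm ℚ (zigzagDual ℚ Z) (T.developedCoord i) = 2 * coord i (T.winding Z) := by
  rw [cupForm_zigzagDual_left Z (T.developedCoord_mem i), ← sum_zigzagChain_smul_disp, map_sum]
  simp only [coord_zsmul, developedCoord]

theorem sum_zigzagChain_mul_crossings (T : D.TorusMarking) (Z Z' : D.Zigzag) :
    ∑ e, zigzagChain Z e * (onZigzag Z' e + onZigzag Z' (D.white⁻¹ e)) =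
      wedge (T.winding Z) (T.winding Z') := by
  have hcup := T.two_mul_cupForm (zigzagDual_mem Z) (zigzagDual_mem Z')
  simp only [cupForm_zigzagDual_developedCoord, coord_zero, coord_one] at hcup
  rw [cupForm_zigzagDual_left Z (zigzagDual_mem Z')] at hcup
  have hcast : ((∑ e, zigzagChain Z e * (onZigzag Z' e + onZigzag Z' (D.white⁻¹ e)) : ℤ) : ℚ) =
      (wedge (T.winding Z) (T.winding Z') : ℤ) := by
    push_cast [wedge]
    simp only [zigzagDual] at hcup
    linear_combination hcup / 4
  exact_mod_cast hcast

end IntersectionNumber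

section Euler

open Classical in
theorem vecMul_boundaryMatrix (T : D.TorusMarking) (g : D.Node ⊕ Fin 2 → ℚ) (e : E) :
    Matrix.vecMul g T.boundaryMatrix e =
      g (Sum.inl (Sum.inr (D.blackEnd e))) - g (Sum.inl (Sum.inl (D.whiteEnd e))) +
        ∑ i, g (Sum.inr i) * coord i (T.disp e) := by
  simp only [Matrix.vecMul, dotProduct, boundaryMatrix, Matrix.of_apply, Fintype.sum_sum_type,
    generator, Sum.elim_inl, Sum.elim_inr, developedCoboundary, developedCoord, Pi.single_apply,
    Pi.zero_apply, zero_sub, sub_zero, mul_neg, mul_ite, mul_one, mul_zero,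
    Finset.sum_neg_distrib, Finset.sum_ite_eq, Finset.mem_univ, if_true]
  ring

open Classical in
theorem eq_zero_of_vecMul_boundaryMatrix_eq_zero (T : D.TorusMarking) {g : D.Node ⊕ Fin 2 → ℚ}
    (hg : Matrix.vecMul g T.boundaryMatrix = 0) (i : Fin 2) : g (Sum.inr i) = 0 := by
  have hpair : ∀ w : ℤ × ℤ, ∑ i, g (Sum.inr i) * coord i w = 0 := fun w => by
    obtain ⟨z, hz, rfl⟩ := T.homology_surjective w
    have hdot := Matrix.dotProduct_mulVec g T.boundaryMatrix fun e => (z e : ℚ)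
    rw [hg, zero_dotProduct, boundaryMatrix_mulVec_intCast] at hdot
    simpa [dotProduct, Fintype.sum_sum_type, hz.1, hz.2] using hdot
  fin_cases i
  · simpa [coord] using hpair (1, 0)
  · simpa [coord] using hpair (0, 1)

open Classical in
theorem ker_transpose_boundaryMatrix (T : D.TorusMarking) (hconn : D.graph.Connected) :
    LinearMap.ker T.boundaryMatrix.transpose.mulVecLin =
      Submodule.span ℚ {Sum.elim (1 : D.Node → ℚ) (0 : Fin 2 → ℚ)} := by
  obtain ⟨e₀⟩ := nonempty_of_connected hconn
  ext g
  rw [LinearMap.mem_ker, Submodule.mem_span_singleton, Matrix.mulVecLin_apply,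
    Matrix.mulVec_transpose]
  constructor
  · intro hg
    have hcoord := T.eq_zero_of_vecMul_boundaryMatrix_eq_zero hg
    have hedge : ∀ e, g (Sum.inl (Sum.inr (D.blackEnd e))) =
        g (Sum.inl (Sum.inl (D.whiteEnd e))) := fun e => by
      have he := congrFun hg e
      simp only [vecMul_boundaryMatrix, hcoord, zero_mul, Finset.sum_const_zero, add_zero,
        Pi.zero_apply] at he
      exact sub_eq_zero.1 he
    have hconst : ∀ e, g (Sum.inl (Sum.inl (D.whiteEnd e))) =
        g (Sum.inl (Sum.inl (D.whiteEnd e₀))) :=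
      edge_induction hconn (fun e he => by rw [whiteEnd_white, he])
        (fun e he => by rw [← hedge, blackEnd_black, hedge, he]) rfl
    refine ⟨g (Sum.inl (Sum.inl (D.whiteEnd e₀))), funext ?_⟩
    rintro ((w | b) | i)
    · obtain ⟨e, rfl⟩ : ∃ e, D.whiteEnd e = w := Quotient.exists_rep w
      simp [hconst e]
    · obtain ⟨e, rfl⟩ : ∃ e, D.blackEnd e = b := Quotient.exists_rep b
      simp [hedge e, hconst e]
    · simp [hcoord i]
  · rintro ⟨a, rfl⟩
    ext e
    simp [vecMul_boundaryMatrix]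

theorem card_edge_eq (T : D.TorusMarking) (hconn : D.graph.Connected) :
    Nat.card E = Nat.card D.WhiteNode + Nat.card D.BlackNode + D.numFaces := by
  classical
  obtain ⟨e₀⟩ := nonempty_of_connected hconn
  have hface := LinearMap.finrank_range_add_finrank_ker D.faceBoundary
  have hedge := LinearMap.finrank_range_add_finrank_ker T.boundaryMatrix.mulVecLin
  have hnode := LinearMap.finrank_range_add_finrank_ker T.boundaryMatrix.transpose.mulVecLin
  have hrank := Matrix.rank_transpose T.boundaryMatrix
  rw [Matrix.rank, Matrix.rank] at hrank
  rw [ker_faceBoundary hconn, finrank_span_singleton fun h =>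
    one_ne_zero (congrFun h (D.leftFace e₀)), Module.finrank_fintype_fun_eq_card] at hface
  rw [T.ker_boundaryMatrix, Module.finrank_fintype_fun_eq_card] at hedge
  rw [T.ker_transpose_boundaryMatrix hconn, finrank_span_singleton fun h =>
    one_ne_zero (congrFun h (Sum.inl (Sum.inl (D.whiteEnd e₀)))),
    Module.finrank_fintype_fun_eq_card, Fintype.card_sum, Fintype.card_sum, Fintype.card_fin]
    at hnode
  simp only [numFaces, Nat.card_eq_fintype_card]
  omega

end Euler

end TorusMarking

end BipartiteMap

namespace BipartiteMap

variable {E : Type*} [Fintype E] {D : BipartiteMap E}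

section Crossings

open Classical in
theorem sum_onZigzag_mul (F : D.Zigzag → ℤ) (e : E) :
    ∑ Z, onZigzag Z e * F Z = F (D.zigzagOf e) := by
  simp [onZigzag]

open Classical in
theorem sum_sum_zigzagChain_mul_crossings (g : D.Zigzag → D.Zigzag → ℤ) (e : E) :
    ∑ Z, ∑ Z', g Z Z' * (zigzagChain Z e * (onZigzag Z' e + onZigzag Z' (D.white⁻¹ e))) =
      g (D.zigzagOf (D.white⁻¹ e)) (D.zigzagOf e) - g (D.zigzagOf e) (D.zigzagOf (D.white⁻¹ e)) +
        (g (D.zigzagOf (D.white⁻¹ e)) (D.zigzagOf (D.white⁻¹ e)) -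
          g (D.zigzagOf e) (D.zigzagOf e)) := by
  have hinner : ∀ Z,
      ∑ Z', g Z Z' * (zigzagChain Z e * (onZigzag Z' e + onZigzag Z' (D.white⁻¹ e))) =
        zigzagChain Z e * (g Z (D.zigzagOf e) + g Z (D.zigzagOf (D.white⁻¹ e))) := fun Z => by
    rw [← sum_onZigzag_mul (g Z) e, ← sum_onZigzag_mul (g Z) (D.white⁻¹ e),
      ← Finset.sum_add_distrib, Finset.mul_sum]
    exact Finset.sum_congr rfl fun Z' _ => by ring
  simp only [hinner]
  simp only [zigzagChain, sub_mul, Finset.sum_sub_distrib, sum_onZigzag_mul]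
  ring

open Classical in
theorem TorusMarking.sum_sum_mul_wedge_winding (T : D.TorusMarking)
    (g : D.Zigzag → D.Zigzag → ℤ) :
    ∑ Z, ∑ Z', g Z Z' * wedge (T.winding Z) (T.winding Z') =
      ∑ e, (g (D.zigzagOf e) (D.zigzagOf (D.white e)) -
        g (D.zigzagOf (D.white e)) (D.zigzagOf e)) := by
  simp only [← sum_zigzagChain_mul_crossings, Finset.mul_sum]
  rw [Finset.sum_congr rfl fun Z _ => Finset.sum_comm, Finset.sum_comm]
  simp only [sum_sum_zigzagChain_mul_crossings]
  rw [Finset.sum_add_distrib, sum_comp_sub_eq_zero D.white⁻¹ fun e =>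
    g (D.zigzagOf e) (D.zigzagOf e), add_zero, ← Equiv.sum_comp D.white]
  simp only [white_inv_white]

open Classical in
theorem TorusMarking.sum_winding (T : D.TorusMarking) : ∑ Z, T.winding Z = 0 := by
  simp only [winding]
  rw [Finset.sum_fiberwise]
  exact sum_comp_sub_eq_zero D.white T.disp

end Crossings

section Area

theorem sum_stepSign_white_eq_black {α : Type*} [LinearOrder α] (θ : D.Zigzag → α) :
    ∑ e, stepSign D.white (θ ∘ D.zigzagOf) e = ∑ e, stepSign D.black (θ ∘ D.zigzagOf) e := by
  rw [← Equiv.sum_comp D.white⁻¹, ← Equiv.sum_comp D.black⁻¹ (stepSign D.black _)]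
  refine Finset.sum_congr rfl fun e _ => ?_
  simp only [stepSign, Function.comp_apply, white_white_inv, black_black_inv, zigzagOf_white_inv]

variable {T : D.TorusMarking} {θ : D.Zigzag → ℝ}

/-- A path with winding zero contributes nothing to the polygon, so `θ` may place it anywhere. -/
theorem two_mul_zigzagArea (hθ : ∀ Z, T.winding Z ≠ 0 → θ Z = vecArg (T.winding Z)) :
    2 * T.zigzagArea = (∑ e, stepSign D.white (θ ∘ D.zigzagOf) e : ℤ) := by
  classical
  have hterm : ∀ Z Z', (if vecArg (T.winding Z) ≤ vecArg (T.winding Z') then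
      (wedge (T.winding Z) (T.winding Z') : ℝ) else 0) =
        (((if θ Z ≤ θ Z' then 1 else 0) * wedge (T.winding Z) (T.winding Z') : ℤ) : ℝ) :=
    fun Z Z' => by
      by_cases hZ : T.winding Z = 0
      · simp [hZ, wedge]
      by_cases hZ' : T.winding Z' = 0
      · simp [hZ', wedge]
      simp [hθ Z hZ, hθ Z' hZ']
  have hsum : _ = ∑ e, stepSign D.white (θ ∘ D.zigzagOf) e :=
    T.sum_sum_mul_wedge_winding fun Z Z' => if θ Z ≤ θ Z' then 1 else 0
  rw [TorusMarking.zigzagArea, two_mul_volume_legPolygon _ T.sum_winding]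
  simp only [Finset.sum_filter]
  rw [Finset.sum_comm]
  simp only [hterm]
  exact_mod_cast hsum

theorem numFaces_eq_two_mul_zigzagArea_iff (hconn : D.graph.Connected)
    (hw : ∀ e, D.white e ≠ e) (hb : ∀ e, D.black e ≠ e)
    (hθ : ∀ Z, T.winding Z ≠ 0 → θ Z = vecArg (T.winding Z)) :
    (D.numFaces : ℝ) = 2 * T.zigzagArea ↔
      HasMaximalAscent D.white (θ ∘ D.zigzagOf) ∧ HasMaximalAscent D.black (θ ∘ D.zigzagOf) := by
  have hEuler : (Nat.card E : ℤ) = Nat.card D.WhiteNode + Nat.card D.BlackNode + D.numFaces :=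
    mod_cast T.card_edge_eq hconn
  have hwhite := sum_stepSign_univ_le (θ ∘ D.zigzagOf) hw
  have hblack := sum_stepSign_univ_le (θ ∘ D.zigzagOf) hb
  rw [two_mul_zigzagArea hθ, ← sum_stepSign_univ_eq_iff _ hw, ← sum_stepSign_univ_eq_iff _ hb,
    ← sum_stepSign_white_eq_black, ← Int.cast_natCast, Int.cast_inj]
  rw [← sum_stepSign_white_eq_black] at hblack
  constructor
  · intro hF
    constructor <;> linarith
  · rintro ⟨h1, h2⟩
    linarith

theorem position_ne_of_numFaces_eq (hconn : D.graph.Connected)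
    (hw : ∀ e, D.white e ≠ e) (hb : ∀ e, D.black e ≠ e)
    (harea : (D.numFaces : ℝ) = 2 * T.zigzagArea)
    (hθ : ∀ Z, T.winding Z ≠ 0 → θ Z = vecArg (T.winding Z)) :
    (∀ e, θ (D.zigzagOf e) ≠ θ (D.zigzagOf (D.white e))) ∧
      ∀ e, θ (D.zigzagOf e) ≠ θ (D.zigzagOf (D.black e)) := by
  suffices hne : ∀ e, θ (D.zigzagOf (D.white⁻¹ e)) ≠ θ (D.zigzagOf e) from
    ⟨fun e => by simpa only [white_inv_white] using hne (D.white e),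
      fun e => by simpa only [zigzagOf_white_inv, black_inv_black] using hne (D.black e)⟩
  obtain ⟨hwmax, hbmax⟩ := (numFaces_eq_two_mul_zigzagArea_iff hconn hw hb hθ).1 harea
  intro e he
  have hall : ∀ e', θ (D.zigzagOf (D.white⁻¹ e')) = θ (D.zigzagOf e') := by
    refine edge_induction hconn (fun x hx => ?_) (fun x hx => ?_) he
    · have hnext := hwmax.apply_eq (hw (D.white⁻¹ x))
      simp only [Function.comp_apply, white_white_inv] at hnext
      rw [white_inv_white, hnext hx.symm]
    · have hnext := hbmax.apply_eq (hb (D.black⁻¹ x))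
      simp only [Function.comp_apply, black_black_inv] at hnext
      rw [zigzagOf_white_inv] at hx ⊢
      rw [black_inv_black, hnext hx.symm]
  have hzero : ∀ e', stepSign D.white (θ ∘ D.zigzagOf) e' = 0 := fun e' => stepSign_eq_zero.2 (by
    simpa only [white_inv_white, Function.comp_apply, eq_comm] using hall (D.white e'))
  rw [two_mul_zigzagArea hθ, Finset.sum_eq_zero fun e' _ => hzero e', Int.cast_zero,
    Nat.cast_eq_zero] at harea
  have : Nonempty D.Face := ⟨D.leftFace e⟩
  exact Nat.card_pos.ne' harea

theorem winding_ne_zero_of_numFaces_eq (hconn : D.graph.Connected)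
    (hw : ∀ e, D.white e ≠ e) (hb : ∀ e, D.black e ≠ e)
    (harea : (D.numFaces : ℝ) = 2 * T.zigzagArea) (Z : D.Zigzag) : T.winding Z ≠ 0 := by
  classical
  intro hZ
  obtain ⟨e, rfl⟩ : ∃ e, D.zigzagOf e = Z := Quotient.exists_rep Z
  -- A path with winding zero can be placed at the direction of a path that it crosses.
  refine (position_ne_of_numFaces_eq hconn hw hb harea
    (θ := fun Y => if T.winding Y = 0 then vecArg (T.winding (D.zigzagOf (D.white e)))
      else vecArg (T.winding Y)) fun Y hY => if_neg hY).1 e ?_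
  simp only [hZ, if_true, ite_self]

end Area

section Nodes

theorem valence_whiteEnd {E : Type*} [Finite E] (D : BipartiteMap E) (e : E) :
    D.valence (Sum.inl (D.whiteEnd e)) = Function.minimalPeriod D.white e :=
  card_mk_sameCycle_eq D.white e

theorem valence_blackEnd {E : Type*} [Finite E] (D : BipartiteMap E) (e : E) :
    D.valence (Sum.inr (D.blackEnd e)) = Function.minimalPeriod D.black e :=
  card_mk_sameCycle_eq D.black e

theorem forall_valence_ne_one_iff {E : Type*} [Finite E] (D : BipartiteMap E) :
    (∀ v, D.valence v ≠ 1) ↔ (∀ e, D.white e ≠ e) ∧ ∀ e, D.black e ≠ e := by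
  rw [Sum.forall]
  refine and_congr (Quotient.mk_surjective.forall.trans (forall_congr' fun e => not_congr ?_))
    (Quotient.mk_surjective.forall.trans (forall_congr' fun e => not_congr ?_))
  · exact (D.valence_whiteEnd e).congr_left.trans Function.minimalPeriod_eq_one_iff_isFixedPt
  · exact (D.valence_blackEnd e).congr_left.trans Function.minimalPeriod_eq_one_iff_isFixedPt

variable (T : D.TorusMarking)

theorem properlyOrdered_iff : T.ProperlyOrdered ↔
    (∀ e, T.OrderedAt D.white e) ∧ ∀ e, T.OrderedAt D.black e := by
  constructor
  · exact fun h => ⟨fun e => h (Sum.inl (D.whiteEnd e)) e rfl,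
      fun e => h (Sum.inr (D.blackEnd e)) e rfl⟩
  · rintro ⟨hwhite, hblack⟩ (w | b)
    · exact fun e _ => hwhite e
    · exact fun e _ => hblack e

theorem forall_orderedAt_iff (rot : Equiv.Perm E) : (∀ e, T.OrderedAt rot e) ↔
    (∀ Z, T.winding Z ≠ 0) ∧
      (∀ e, vecArg (T.winding (D.zigzagOf e)) ≠ vecArg (T.winding (D.zigzagOf (rot e)))) ∧
      HasMaximalAscent rot ((fun Z => vecArg (T.winding Z)) ∘ D.zigzagOf) := by
  set θ : E → ℝ := (fun Z => vecArg (T.winding Z)) ∘ D.zigzagOf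
  have hrange : ∀ e, θ e ∈ Set.Ioc (-Real.pi) Real.pi := fun e => vecArg_mem_Ioc _
  constructor
  · intro h
    have hne : ∀ e, θ e ≠ θ (rot e) := fun e he =>
      (h e).2.1 e (Equiv.Perm.SameCycle.refl rot e) (congrArg Real.Angle.coe he)
    refine ⟨fun Z => ?_, hne, fun e => ?_⟩
    · obtain ⟨e, rfl⟩ : ∃ e, D.zigzagOf e = Z := Quotient.exists_rep Z
      exact (h e).1 e (Equiv.Perm.SameCycle.refl rot e)
    · exact (sum_stepSign_eq_iff fun he => hne e (congrArg θ he.symm)).2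
        (Or.inl (exists_increasesFrom_of_sbtw_coe hrange (h e).2.1 (h e).2.2))
  · rintro ⟨hwinding, hne, hmax⟩ e
    obtain ⟨m, hem, hm⟩ | ⟨hconst, -⟩ :=
      (sum_stepSign_eq_iff fun he => hne e (congrArg θ he.symm)).1 (hmax e)
    · exact ⟨fun e' _ => hwinding _,
        fun e' _ h => hne e' ((coe_angle_inj_of_mem_Ioc (hrange e') (hrange (rot e'))).1 h),
        fun e' he' i j => hm.sbtw_coe hrange (hem.symm.trans he')⟩
    · exact absurd (hconst e (Equiv.Perm.SameCycle.refl rot e)).symm (hne e)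

end Nodes

end BipartiteMap

open BipartiteMap

theorem mainTheorem1 {E : Type*} [Fintype E] (D : BipartiteMap E) (T : D.TorusMarking)
    (hconn : D.graph.Connected) :
    T.ProperlyOrdered ↔
      (∀ v : D.Node, D.valence v ≠ 1) ∧ (D.numFaces : ℝ) = 2 * T.zigzagArea := by
  rw [properlyOrdered_iff, forall_orderedAt_iff, forall_orderedAt_iff, forall_valence_ne_one_iff]
  constructor
  · rintro ⟨⟨-, hwhite, hwmax⟩, -, hblack, hbmax⟩
    have hw : ∀ e, D.white e ≠ e := fun e he => hwhite e (by rw [he])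
    have hb : ∀ e, D.black e ≠ e := fun e he => hblack e (by rw [he])
    exact ⟨⟨hw, hb⟩,
      (numFaces_eq_two_mul_zigzagArea_iff hconn hw hb fun _ _ => rfl).2 ⟨hwmax, hbmax⟩⟩
  · rintro ⟨⟨hw, hb⟩, harea⟩
    have hwinding := winding_ne_zero_of_numFaces_eq hconn hw hb harea
    obtain ⟨hwmax, hbmax⟩ :=
      (numFaces_eq_two_mul_zigzagArea_iff hconn hw hb fun _ _ => rfl).1 harea
    obtain ⟨hwhite, hblack⟩ := position_ne_of_numFaces_eq hconn hw hb harea fun _ _ => rfl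
    exact ⟨⟨hwinding, hwhite, hwmax⟩, hwinding, hblack, hbmax⟩
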